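/- Let $r=|x|$ denote the distance to the origin in $\mathbb R^2$. Let $\mu\ge 1$ and let $f\in C^\infty(\mathbb R^2)$ be a real-valued function such that for every integer $k\ge 0$ there is a constant $C_k$ with $|\nabla^k f|\le C_k r^{-\mu-k}$ on $\mathbb R^2\setminus\{0\}$. For smooth $u:\mathbb R^2\to\mathbb R$ define, with all estimates understood as $r\to\infty$ and with implied constants that may depend on $u$ and $k$: 1. $u\in\mathcal D^\infty_{r\log r}$ if $u=O(r\log r)$, $|\nabla u|=O(\log r)$ and $|\nabla^k u|=O(r^{1-k})$ for all $k\ge 2$; 2. $u\in\mathcal D^\infty_{r^\delta}$ if $|\nabla^k u|=O(r^{\delta-k})$ for all $k\ge 0$; 3. $u\in\mathcal D^\infty_{(\log r)^2}$ if $u=O((\log r)^2)$ and $|\nabla^k u|=O(r^{-k}\log r)$ for all $k\ge 1$; 4. $u\in\mathcal D^\infty_{\log r}$ if $u=O(\log r)$ and $|\nabla^k u|=O(r^{-k})$ for all $k\ge 1$. Let $\mathcal D_\mu$ be $\mathcal D^\infty_{r\log r}$ if $\mu=1$, $\mathcal D^\infty_{r^{2-\mu}}$ if $1<\mu<2$,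 $\mathcal D^\infty_{(\log r)^2}$ if $\mu=2$, and $\mathcal D^\infty_{\log r}$ if $\mu>2$. Then the Poisson equation $\Delta u=f$ on $\mathbb R^2$ has a smooth solution $u\in\mathcal D_\mu$. It is unique up to linear functions $x\mapsto \langle a,x\rangle+c$ with $a\in\mathbb R^2$, $c\in\mathbb R$: every solution $v\in\mathcal D_\mu$ of $\Delta v=f$ differs from $u$ by such a function, and, more generally, the $C^2$ solutions $v$ of $\Delta v=f$ with $v=o(r^2)$ as $r\to\infty$ are exactly the functions $u+\langle a,x\rangle+c$. -/

import Mathlib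

open scoped ContDiff Laplacian

/-- The Euclidean plane `ℝ²`; the distance `r` to the origin is `‖x‖`, and `|∇ᵏu|` is the operator
norm of the `k`-th derivative `iteratedFDeriv ℝ k u` (equivalent, up to a factor that depends on `k`
only, to any other norm on `k`-tensors). -/
abbrev Plane : Type := EuclideanSpace ℝ (Fin 2)

/-- `|∇ᵏf| ≤ C_k r^{-μ-k}` for every `k ≥ 0` (away from the origin, where `r^{-μ-k}` is infinite). -/
def HasSymbolDecay (μ : ℝ) (f : Plane → ℝ) : Prop :=
  ∀ k : ℕ, ∃ C : ℝ, ∀ x : Plane, x ≠ 0 → ‖iteratedFDeriv ℝ k f x‖ ≤ C * ‖x‖ ^ (-μ - (k : ℝ))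

/-- `|∇ᵏu| = O(φ(r))` as `r → ∞`. -/
def DerivBigO (u : Plane → ℝ) (k : ℕ) (φ : ℝ → ℝ) : Prop :=
  (fun x : Plane => iteratedFDeriv ℝ k u x) =O[Bornology.cobounded Plane] (fun x => φ ‖x‖)

/-- The class `𝒟^∞_{r log r}(ℝ²)`: smooth functions with `u = O(r log r)`, `|∇u| = O(log r)` and
`|∇ᵏu| = O(r^{1-k})` for `k ≥ 2`. -/
def DClassRLogR : Set (Plane → ℝ) :=
  {u | ContDiff ℝ ∞ u ∧ DerivBigO u 0 (fun r => r * Real.log r) ∧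
    DerivBigO u 1 (fun r => Real.log r) ∧
    ∀ k : ℕ, 2 ≤ k → DerivBigO u k (fun r => r ^ (1 - (k : ℝ)))}

/-- The class `𝒟^∞_{r^δ}(ℝ²)`: smooth functions with `|∇ᵏu| = O(r^{δ-k})` for `k ≥ 0`. -/
def DClassRPow (δ : ℝ) : Set (Plane → ℝ) :=
  {u | ContDiff ℝ ∞ u ∧ ∀ k : ℕ, DerivBigO u k (fun r => r ^ (δ - (k : ℝ)))}

/-- The class `𝒟^∞_{(log r)²}(ℝ²)`: smooth functions with `u = O((log r)²)` and
`|∇ᵏu| = O(r^{-k} log r)` for `k ≥ 1`. -/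
def DClassLogSq : Set (Plane → ℝ) :=
  {u | ContDiff ℝ ∞ u ∧ DerivBigO u 0 (fun r => Real.log r ^ 2) ∧
    ∀ k : ℕ, 1 ≤ k → DerivBigO u k (fun r => r ^ (-(k : ℝ)) * Real.log r)}

/-- The class `𝒟^∞_{log r}(ℝ²)`: smooth functions with `u = O(log r)` and `|∇ᵏu| = O(r^{-k})` for
`k ≥ 1`. -/
def DClassLog : Set (Plane → ℝ) :=
  {u | ContDiff ℝ ∞ u ∧ DerivBigO u 0 (fun r => Real.log r) ∧
    ∀ k : ℕ, 1 ≤ k → DerivBigO u k (fun r => r ^ (-(k : ℝ)))}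

/-- The class attached to the decay rate `μ ≥ 1`: `𝒟^∞_{r log r}` for `μ = 1`, `𝒟^∞_{r^{2-μ}}` for
`1 < μ < 2`, `𝒟^∞_{(log r)²}` for `μ = 2` and `𝒟^∞_{log r}` for `μ > 2`. -/
def InSolutionClass (μ : ℝ) (u : Plane → ℝ) : Prop :=
  (μ = 1 → u ∈ DClassRLogR) ∧
  (1 < μ ∧ μ < 2 → u ∈ DClassRPow (2 - μ)) ∧
  (μ = 2 → u ∈ DClassLogSq) ∧
  (2 < μ → u ∈ DClassLog)

/-- `v` and `u` differ by a linear function `x ↦ L x + c` (constants included). -/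
def DifferByLinear (v u : Plane → ℝ) : Prop :=
  ∃ (L : Plane →ₗ[ℝ] ℝ) (c : ℝ), ∀ x, v x = u x + (L x + c)

/-!
The solution is assembled from Newton potentials of dyadic pieces of `f`.

The logarithm is a multiple of the fundamental solution of the Laplacian
(`integral_log_norm_mul_laplacian`): regularize it to `½ log (ε² + |t|²)`, whose Laplacian is an
approximate identity of fixed mass, integrate by parts and let `ε → 0`. Hence the convolution `v` of
a test function `g` with the normalized logarithm solves `Δv = g`. If `g` lives in the disc of
radius `2`, the derivatives of order `k ≥ 1` of `v` are `O((1 + r)⁻ᵏ)`, with constants controlled by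
sup norms of `g` and its derivatives (`exists_norm_iteratedFDeriv_newtonPotential_le`).

Cut `f` into pieces living at `|x| ~ 2^j`. The decay of `f` is scale invariant, so the rescaled
pieces are bounded in every `C^k` uniformly in `j`, and the `k`-th derivative of the potential of
the `j`-th piece is bounded by a constant times `2^(j(2-μ)) / (2^j + r)^k`. These bounds are
summable over `j` as soon as `k > 2 - μ`: for `k ≥ 1` if `μ > 1`, and for `k ≥ 2` if `μ = 1`.
Subtracting from each potential its Taylor polynomial at the origin, of degree `0` if `μ > 1` and of
degree `1` if `μ = 1`, makes the series converge with all derivatives, locally uniformly, to a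
solution `u`. The dyadic sum is evaluated by splitting it at `2^j ~ r`
(`exists_tsum_le_dyadicGrowth`), which gives the required decay of the derivatives of order at least
`1`, or at least `2` if `μ = 1`. The remaining growth bounds follow by integration along rays from
the origin, where the normalized sum and, for `μ = 1`, its gradient vanish.

For uniqueness, the difference of two solutions of growth `o(r²)` is a harmonic function of growth
`o(r²)`, hence the real part of an entire function. The Borel–Carathéodory inequality and Cauchy's
estimate show that the second derivative of this entire function vanishes, so the difference is
affine (`exists_affine_of_laplacian_eq_zero_of_isLittleO`).
-/

open MeasureTheory Filter Topology

/-! ### Harmonic functions of subquadratic growth -/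

/-- The Laplacian on the plane as a sum over the standard basis. -/
lemma laplacian_eq_sum_single (w : Plane → ℝ) (x : Plane) :
    (Δ w) x = ∑ i : Fin 2, iteratedFDeriv ℝ 2 w x
      ![EuclideanSpace.single i 1, EuclideanSpace.single i 1] := by
  rw [InnerProductSpace.laplacian_eq_iteratedFDeriv_orthonormalBasis w
    (EuclideanSpace.basisFun (Fin 2) ℝ)]
  simp

/-- The isometry `ℂ ≃ Plane`, `z ↦ (re z, im z)`. -/
noncomputable def complexToPlane : ℂ ≃ₗᵢ[ℝ] Plane := Complex.orthonormalBasisOneI.repr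

lemma laplacian_comp_complexToPlane {w : Plane → ℝ} (hw : ContDiff ℝ 2 w) (z : ℂ) :
    (Δ (w ∘ complexToPlane)) z = (Δ w) (complexToPlane z) := by
  rw [InnerProductSpace.laplacian_eq_iteratedFDeriv_orthonormalBasis _
    Complex.orthonormalBasisOneI, laplacian_eq_sum_single]
  have h := ContinuousLinearMap.iteratedFDeriv_comp_right
    (complexToPlane.toContinuousLinearEquiv : ℂ →L[ℝ] Plane) hw z (i := 2) le_rfl
  refine Finset.sum_congr rfl fun i _ => ?_
  change iteratedFDeriv ℝ 2
    (w ∘ (complexToPlane.toContinuousLinearEquiv : ℂ →L[ℝ] Plane)) z _ = _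
  rw [h, ContinuousMultilinearMap.compContinuousLinearMap_apply]
  congr 1
  ext j : 1
  fin_cases j <;> exact Complex.orthonormalBasisOneI.repr_self i

/-- An entire function whose real part is `o(|z|²)` has vanishing second derivative: the
Borel–Carathéodory inequality turns the bound on the real part into a bound on the function, to
which Cauchy's estimate applies. -/
lemma iteratedDeriv_two_eq_zero_of_re_isLittleO {F : ℂ → ℂ} (hF : Differentiable ℂ F)
    (ho : (fun z => (F z).re) =o[Bornology.cobounded ℂ] (fun z => ‖z‖ ^ 2)) (c : ℂ) :
    iteratedDeriv 2 F c = 0 := by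
  have key : ∀ ε > 0, ∃ A > 0, ∀ z, (F z).re ≤ A + ε * ‖z‖ ^ 2 := by
    intro ε hε
    have h1 := ho.def hε
    rw [Filter.Eventually, ← comap_norm_atTop, Filter.mem_comap] at h1
    obtain ⟨t, ht, hsub⟩ := h1
    obtain ⟨R, hR⟩ := Filter.mem_atTop_sets.1 ht
    obtain ⟨B, hB⟩ := (isCompact_closedBall (0 : ℂ) R).exists_bound_of_continuousOn
      (f := F) hF.continuous.continuousOn
    refine ⟨|B| + 1, by positivity, fun z => ?_⟩
    by_cases hz : ‖z‖ ≤ R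
    · have h2 := hB z (by simpa using hz)
      have h3 := (Complex.re_le_norm (F z)).trans h2
      have h4 := le_abs_self B
      nlinarith [sq_nonneg ‖z‖]
    · have h2 : ‖(F z).re‖ ≤ ε * ‖‖z‖ ^ 2‖ := hsub (hR _ (not_le.1 hz).le)
      rw [Real.norm_eq_abs, norm_pow, norm_norm] at h2
      linarith [le_abs_self (F z).re, abs_nonneg B]
  rw [← norm_le_zero_iff]
  refine le_of_forall_pos_le_add fun δ hδ => ?_
  obtain ⟨A, hA, hbd⟩ := key (δ / 320) (by positivity)
  -- On the disc of radius `4R` the real part is at most `A + (δ / 320) (4R)²`, which makes `F` at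
  -- most twice that plus `3 |F 0|` on the disc of radius `2R`, and Cauchy's estimate on the circle
  -- of radius `R` about `c` then bounds the second derivative by `δ / 5 + O(1 / R)`.
  obtain ⟨R, hR1, hRc, hRF, hRA⟩ : ∃ R : ℝ, 1 ≤ R ∧ ‖c‖ ≤ R ∧
      24 * ‖F 0‖ ≤ δ * R ∧ 32 * A ≤ δ * R := by
    refine ⟨1 + ‖c‖ + 24 * ‖F 0‖ / δ + 32 * A / δ, ?_, ?_, ?_, ?_⟩
    · have : 0 ≤ 24 * ‖F 0‖ / δ + 32 * A / δ := by positivity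
      linarith [norm_nonneg c]
    · have : 0 ≤ 24 * ‖F 0‖ / δ + 32 * A / δ := by positivity
      linarith [norm_nonneg c]
    · have : 24 * ‖F 0‖ = δ * (24 * ‖F 0‖ / δ) := by field_simp
      have h2 : 0 ≤ δ * (1 + ‖c‖ + 32 * A / δ) := by positivity
      linarith
    · have : 32 * A = δ * (32 * A / δ) := by field_simp
      have h2 : 0 ≤ δ * (1 + ‖c‖ + 24 * ‖F 0‖ / δ) := by positivity
      linarith
  have hRpos : 0 < R := by linarith
  set M := A + δ / 320 * (4 * R) ^ 2 with hM
  have hMpos : 0 < M := by positivity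
  have hmaps : Set.MapsTo F (Metric.ball 0 (4 * R)) {z | z.re ≤ M} := by
    intro z hz
    have hz' : ‖z‖ < 4 * R := by simpa using hz
    refine (hbd z).trans ?_
    rw [hM]
    gcongr
  have hsph : ∀ z ∈ Metric.sphere c R, ‖F z‖ ≤ 2 * M + 3 * ‖F 0‖ := by
    intro z hz
    have hz1 : ‖z‖ ≤ 2 * R := by
      have : ‖z - c‖ = R := by simpa [dist_eq_norm] using hz
      calc ‖z‖ = ‖(z - c) + c‖ := by ring_nf
        _ ≤ ‖z - c‖ + ‖c‖ := norm_add_le _ _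
        _ ≤ 2 * R := by linarith
    have h1 := Complex.borelCaratheodory hMpos hF.differentiableOn hmaps (by linarith)
      (z := z) (by simpa using by linarith)
    refine h1.trans (add_le_add ?_ ?_)
    · rw [div_le_iff₀ (by linarith)]
      nlinarith
    · rw [div_le_iff₀ (by linarith)]
      nlinarith [norm_nonneg (F 0)]
  have h2 := Complex.norm_iteratedDeriv_le_of_forall_mem_sphere_norm_le 2 hRpos
    (hF.diffContOnCl) hsph
  refine h2.trans ?_
  rw [div_le_iff₀ (by positivity), hM]
  norm_num [Nat.factorial]
  have e1 : δ * R ≤ δ * R ^ 2 := by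
    have : R ≤ R ^ 2 := by nlinarith
    gcongr
  nlinarith

/-- **Liouville's theorem** for harmonic functions of growth `o(r²)` on the plane. -/
theorem exists_affine_of_laplacian_eq_zero_of_isLittleO {w : Plane → ℝ} (hw : ContDiff ℝ 2 w)
    (hΔ : ∀ x, (Δ w) x = 0) (ho : w =o[Bornology.cobounded Plane] (fun x => ‖x‖ ^ 2)) :
    ∃ (L : Plane →ₗ[ℝ] ℝ) (c : ℝ), ∀ x, w x = L x + c := by
  have hharm : InnerProductSpace.HarmonicOnNhd (w ∘ complexToPlane) Set.univ := by
    intro z _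
    refine ⟨(hw.comp complexToPlane.contDiff).contDiffAt, Filter.Eventually.of_forall fun y => ?_⟩
    rw [laplacian_comp_complexToPlane hw, hΔ]
    rfl
  obtain ⟨F, hFan, hFre⟩ := hharm.exists_analyticOnNhd_univ_re_eq
  have hF : Differentiable ℂ F := fun z => (hFan z trivial).differentiableAt
  have ho' : (fun z => (F z).re) =o[Bornology.cobounded ℂ] (fun z => ‖z‖ ^ 2) := by
    rw [hFre]
    have htend : Filter.Tendsto complexToPlane (Bornology.cobounded ℂ)
        (Bornology.cobounded Plane) := by
      rw [← tendsto_norm_atTop_iff_cobounded]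
      simpa using tendsto_norm_cobounded_atTop
    simpa [Function.comp_def] using ho.comp_tendsto htend
  have h2 := iteratedDeriv_two_eq_zero_of_re_isLittleO hF ho'
  have hF' : Differentiable ℂ (deriv F) := fun z => (hFan.deriv z trivial).differentiableAt
  have hconst : ∀ z, deriv F z = deriv F 0 := fun z =>
    is_const_of_deriv_eq_zero hF' (fun y => by simpa [iteratedDeriv_succ] using h2 y) z 0
  have hlin : ∀ z, F z = F 0 + deriv F 0 * z := by
    intro z
    have h3 := is_const_of_deriv_eq_zero (f := fun z => F z - deriv F 0 * z) (by fun_prop)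
      (fun y => by
        rw [deriv_fun_sub (hF y) (by fun_prop), deriv_const_mul _ (by fun_prop), hconst y]
        simp) z 0
    simp only [mul_zero, sub_zero] at h3
    linear_combination h3
  refine ⟨Complex.reLm ∘ₗ (LinearMap.mulLeft ℝ (deriv F 0)) ∘ₗ
    (complexToPlane.symm.toLinearEquiv : Plane →ₗ[ℝ] ℂ), (F 0).re, fun x => ?_⟩
  have h4 := congrFun hFre (complexToPlane.symm x)
  simp only [Function.comp_apply, LinearIsometryEquiv.apply_symm_apply] at h4
  rw [← h4, hlin (complexToPlane.symm x), Complex.add_re, add_comm]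
  rfl

/-! ### The logarithm as a fundamental solution -/

lemma iteratedFDeriv_two_diag_eq {w : Plane → ℝ} (hw : ContDiff ℝ 2 w) (x e : Plane) :
    iteratedFDeriv ℝ 2 w x ![e, e] = fderiv ℝ (fun y => fderiv ℝ w y e) x e := by
  rw [iteratedFDeriv_two_apply]
  have h : DifferentiableAt ℝ (fderiv ℝ w) x :=
    ((hw.fderiv_right (m := 1) (by norm_num)).differentiable (by norm_num)) x
  rw [fderiv_clm_apply h (by fun_prop)]
  simp

lemma laplacian_eq_sum_fderiv {w : Plane → ℝ} (hw : ContDiff ℝ 2 w) (x : Plane) :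
    (Δ w) x = ∑ i : Fin 2, fderiv ℝ (fun y => fderiv ℝ w y (EuclideanSpace.single i 1)) x
      (EuclideanSpace.single i 1) := by
  rw [laplacian_eq_sum_single]
  exact Finset.sum_congr rfl fun i _ => iteratedFDeriv_two_diag_eq hw x _

lemma continuous_laplacian {w : Plane → ℝ} (hw : ContDiff ℝ 2 w) : Continuous (Δ w) := by
  have : Δ w = fun x => ∑ i : Fin 2, iteratedFDeriv ℝ 2 w x
      ![EuclideanSpace.single i 1, EuclideanSpace.single i 1] :=
    funext (laplacian_eq_sum_single w)
  rw [this]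
  refine continuous_finsetSum _ fun i _ => ?_
  have h := hw.continuous_iteratedFDeriv (m := 2) le_rfl
  exact h.eval_const _

lemma contDiff_fderiv_apply_const {w : Plane → ℝ} {n : WithTop ℕ∞} (hw : ContDiff ℝ (n + 1) w)
    (e : Plane) : ContDiff ℝ n (fun y => fderiv ℝ w y e) :=
  (hw.fderiv_right le_rfl).clm_apply contDiff_const

lemma HasCompactSupport.fderiv_apply_const {w : Plane → ℝ} (hw : HasCompactSupport w)
    (e : Plane) : HasCompactSupport (fun y => fderiv ℝ w y e) :=
  (hw.fderiv ℝ).comp_left (g := fun L : Plane →L[ℝ] ℝ => L e) rfl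

lemma HasCompactSupport.laplacian {w : Plane → ℝ} (hw : HasCompactSupport w)
    (hw2 : ContDiff ℝ 2 w) : HasCompactSupport (Δ w) := by
  have h : HasCompactSupport (fun x => ∑ i : Fin 2,
      fderiv ℝ (fun y => fderiv ℝ w y (EuclideanSpace.single i 1)) x
      (EuclideanSpace.single i 1)) := by
    simp only [Fin.sum_univ_two]
    exact ((hw.fderiv_apply_const _).fderiv_apply_const _).add
      ((hw.fderiv_apply_const _).fderiv_apply_const _)
  convert h using 1
  exact funext (laplacian_eq_sum_fderiv hw2)

lemma integral_mul_fderiv_eq_neg_of_hasCompactSupport {a h : Plane → ℝ} (ha : ContDiff ℝ 1 a)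
    (hh : ContDiff ℝ 1 h) (hc : HasCompactSupport h) (e : Plane) :
    ∫ t, a t * fderiv ℝ h t e = -∫ t, fderiv ℝ a t e * h t := by
  have ca : Continuous fun t => fderiv ℝ a t e :=
    (contDiff_fderiv_apply_const (n := 0) (by simpa using ha) e).continuous
  have ch : Continuous fun t => fderiv ℝ h t e :=
    (contDiff_fderiv_apply_const (n := 0) (by simpa using hh) e).continuous
  refine integral_mul_fderiv_eq_neg_fderiv_mul_of_integrable ?_ ?_ ?_ ?_ ?_
  · exact (ca.mul hh.continuous).integrable_of_hasCompactSupport hc.mul_left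
  · exact (ha.continuous.mul ch).integrable_of_hasCompactSupport
      (hc.fderiv_apply_const e).mul_left
  · exact (ha.continuous.mul hh.continuous).integrable_of_hasCompactSupport hc.mul_left
  · exact fun x _ => (ha.differentiable (by norm_num)) x
  · exact fun x _ => (hh.differentiable (by norm_num)) x

/-- Green's second identity when one of the functions has compact support. -/
lemma integral_mul_laplacian_eq {a h : Plane → ℝ} (ha : ContDiff ℝ 2 a)
    (hh : ContDiff ℝ 2 h) (hc : HasCompactSupport h) :
    ∫ t, a t * (Δ h) t = ∫ t, (Δ a) t * h t := by
  have da : ∀ e, ContDiff ℝ 1 fun t => fderiv ℝ a t e := fun e =>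
    contDiff_fderiv_apply_const (n := 1) (by simpa [one_add_one_eq_two] using ha) e
  have dh : ∀ e, ContDiff ℝ 1 fun t => fderiv ℝ h t e := fun e =>
    contDiff_fderiv_apply_const (n := 1) (by simpa [one_add_one_eq_two] using hh) e
  have dda : ∀ e, Continuous fun t => fderiv ℝ (fun y => fderiv ℝ a y e) t e := fun e =>
    (contDiff_fderiv_apply_const (n := 0) (by simpa using da e) e).continuous
  have ddh : ∀ e, Continuous fun t => fderiv ℝ (fun y => fderiv ℝ h y e) t e := fun e =>
    (contDiff_fderiv_apply_const (n := 0) (by simpa using dh e) e).continuous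
  have key : ∀ e, ∫ t, a t * fderiv ℝ (fun y => fderiv ℝ h y e) t e =
      ∫ t, fderiv ℝ (fun y => fderiv ℝ a y e) t e * h t := by
    intro e
    rw [integral_mul_fderiv_eq_neg_of_hasCompactSupport (ha.of_le (by norm_num)) (dh e)
      (hc.fderiv_apply_const e),
      integral_mul_fderiv_eq_neg_of_hasCompactSupport (da e) (hh.of_le (by norm_num)) hc, neg_neg]
  simp_rw [laplacian_eq_sum_fderiv ha, laplacian_eq_sum_fderiv hh, Finset.mul_sum, Finset.sum_mul]
  rw [integral_finsetSum, integral_finsetSum]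
  · exact Finset.sum_congr rfl fun i _ => key _
  · exact fun i _ => ((dda _).mul hh.continuous).integrable_of_hasCompactSupport hc.mul_left
  · exact fun i _ => (ha.continuous.mul (ddh _)).integrable_of_hasCompactSupport
      ((hc.fderiv_apply_const _).fderiv_apply_const _).mul_left

/-- The smooth regularization `½ log (ε² + |t|²)` of `log |t|`. -/
noncomputable def regLog (ε : ℝ) (t : Plane) : ℝ := 1 / 2 * Real.log (ε ^ 2 + ‖t‖ ^ 2)

lemma contDiff_regLog {ε : ℝ} (hε : 0 < ε) : ContDiff ℝ ∞ (regLog ε) := by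
  unfold regLog
  refine contDiff_const.mul (ContDiff.log ?_ fun t => by positivity)
  exact contDiff_const.add (contDiff_norm_sq ℝ)

lemma hasFDerivAt_norm_sq (t : Plane) :
    HasFDerivAt (fun t : Plane => ‖t‖ ^ 2) (2 • innerSL ℝ t) t :=
  (hasStrictFDerivAt_norm_sq t).hasFDerivAt

lemma fderiv_regLog_apply {ε : ℝ} (hε : 0 < ε) (t e : Plane) :
    fderiv ℝ (regLog ε) t e = inner ℝ t e / (ε ^ 2 + ‖t‖ ^ 2) := by
  have h1 : HasFDerivAt (regLog ε) ((1 / 2 : ℝ) • ((ε ^ 2 + ‖t‖ ^ 2)⁻¹ • (2 • innerSL ℝ t))) t :=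
    (((hasFDerivAt_norm_sq t).const_add (ε ^ 2)).log (by positivity)).const_mul (1 / 2)
  rw [h1.fderiv]
  simp
  field_simp

lemma fderiv_fderiv_regLog_apply {ε : ℝ} (hε : 0 < ε) (t e : Plane) :
    fderiv ℝ (fun y => fderiv ℝ (regLog ε) y e) t e =
      ‖e‖ ^ 2 / (ε ^ 2 + ‖t‖ ^ 2) - 2 * (inner ℝ t e) ^ 2 / (ε ^ 2 + ‖t‖ ^ 2) ^ 2 := by
  have h0 : (fun y => fderiv ℝ (regLog ε) y e) =
      fun y => innerSL ℝ e y * (ε ^ 2 + ‖y‖ ^ 2)⁻¹ := by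
    funext y
    rw [fderiv_regLog_apply hε, div_eq_mul_inv, innerSL_apply_apply, real_inner_comm]
  have hpos : ε ^ 2 + ‖t‖ ^ 2 ≠ 0 := by positivity
  have h1 := (innerSL ℝ e).hasFDerivAt (x := t) |>.mul
    ((hasDerivAt_inv hpos).comp_hasFDerivAt t ((hasFDerivAt_norm_sq t).const_add (ε ^ 2)))
  have h2 : fderiv ℝ (fun y => innerSL ℝ e y * (ε ^ 2 + ‖y‖ ^ 2)⁻¹) t = _ := h1.fderiv
  rw [h0, h2]
  simp [real_inner_comm t e]
  field_simp
  ring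

lemma laplacian_regLog {ε : ℝ} (hε : 0 < ε) (t : Plane) :
    (Δ (regLog ε)) t = 2 * ε ^ 2 / (ε ^ 2 + ‖t‖ ^ 2) ^ 2 := by
  rw [laplacian_eq_sum_fderiv (mod_cast contDiff_infty.1 (contDiff_regLog hε) 2)]
  simp_rw [fderiv_fderiv_regLog_apply hε]
  have hn : ‖t‖ ^ 2 = t 0 ^ 2 + t 1 ^ 2 := by
    rw [EuclideanSpace.norm_sq_eq]; simp
  have hpos : ε ^ 2 + (t 0 ^ 2 + t 1 ^ 2) ≠ 0 := by positivity
  simp [EuclideanSpace.inner_single_right, hn]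
  field_simp
  ring

/-- The mass `∫ Δ (½ log (1 + |s|²)) ds`, the flux of the logarithm (its value is `2π`). -/
noncomputable def logFlux : ℝ := ∫ s : Plane, 2 / (1 + ‖s‖ ^ 2) ^ 2

lemma integrable_two_div_one_add_norm_sq_sq :
    Integrable fun s : Plane => 2 / (1 + ‖s‖ ^ 2) ^ 2 := by
  have h := (integrable_rpow_neg_one_add_norm_sq (μ := (volume : Measure Plane)) (r := 4)
    (by simp; norm_num)).const_mul 2
  refine h.congr (Eventually.of_forall fun s => ?_)
  have : (-4 / 2 : ℝ) = -((2 : ℕ) : ℝ) := by norm_num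
  simp only [this, Real.rpow_neg (show 0 ≤ 1 + ‖s‖ ^ 2 by positivity), Real.rpow_natCast]
  rw [div_eq_mul_inv]

lemma logFlux_pos : 0 < logFlux := by
  unfold logFlux
  rw [integral_pos_iff_support_of_nonneg (fun s => by positivity)
    integrable_two_div_one_add_norm_sq_sq]
  have : (Function.support fun s : Plane => 2 / (1 + ‖s‖ ^ 2) ^ 2) = Set.univ := by
    ext s
    simp only [Function.mem_support, Set.mem_univ, iff_true]
    positivity
  rw [this]
  simp

/-- The Laplacians of the regularized logarithms are the dilates of a single profile. -/
lemma integral_laplacian_regLog_mul {ε : ℝ} (hε : 0 < ε) (h : Plane → ℝ) :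
    ∫ t, (Δ (regLog ε)) t * h t = ∫ s : Plane, 2 / (1 + ‖s‖ ^ 2) ^ 2 * h (ε • s) := by
  have h1 := Measure.integral_comp_smul (volume : Measure Plane)
    (fun t => (Δ (regLog ε)) t * h t) ε
  rw [finrank_euclideanSpace, Fintype.card_fin, abs_of_pos (by positivity), smul_eq_mul] at h1
  have h2 : ∫ t, (Δ (regLog ε)) t * h t =
      ε ^ 2 * ∫ s : Plane, (Δ (regLog ε)) (ε • s) * h (ε • s) := by
    rw [h1]
    field_simp
  rw [h2, ← integral_const_mul]
  congr 1
  funext s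
  rw [laplacian_regLog hε, norm_smul, Real.norm_of_nonneg hε.le]
  have : (1 + ‖s‖ ^ 2) ≠ 0 := by positivity
  have h3 : ε ^ 2 + (ε * ‖s‖) ^ 2 = ε ^ 2 * (1 + ‖s‖ ^ 2) := by ring
  rw [h3]
  field_simp

lemma tendsto_integral_laplacian_regLog_mul {h : Plane → ℝ} (hh : Continuous h)
    (hc : HasCompactSupport h) :
    Tendsto (fun ε => ∫ t, (Δ (regLog ε)) t * h t) (𝓝[>] 0) (𝓝 (logFlux * h 0)) := by
  have h1 : Tendsto (fun ε : ℝ => ∫ s : Plane, 2 / (1 + ‖s‖ ^ 2) ^ 2 * h (ε • s)) (𝓝[>] 0)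
      (𝓝 (∫ s : Plane, 2 / (1 + ‖s‖ ^ 2) ^ 2 * h 0)) := by
    obtain ⟨C, hC⟩ := hc.exists_bound_of_continuous hh
    have cont : Continuous fun s : Plane => 2 / (1 + ‖s‖ ^ 2) ^ 2 := by
      refine continuous_const.div (by fun_prop) fun s => by positivity
    refine tendsto_integral_filter_of_dominated_convergence
      (fun s => 2 / (1 + ‖s‖ ^ 2) ^ 2 * C) ?_ ?_ ?_ ?_
    · exact Eventually.of_forall fun ε => (by fun_prop : Continuous _).aestronglyMeasurable
    · refine Eventually.of_forall fun ε => Eventually.of_forall fun s => ?_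
      rw [norm_mul, Real.norm_of_nonneg (by positivity)]
      gcongr
      exact hC _
    · exact integrable_two_div_one_add_norm_sq_sq.mul_const C
    · refine Eventually.of_forall fun s => ?_
      have : Tendsto (fun ε : ℝ => h (ε • s)) (𝓝 0) (𝓝 (h ((0 : ℝ) • s))) :=
        (by fun_prop : Continuous fun ε : ℝ => h (ε • s)).tendsto 0
      rw [zero_smul] at this
      exact (this.mono_left nhdsWithin_le_nhds).const_mul _
  rw [integral_mul_const] at h1
  refine h1.congr' ?_
  filter_upwards [self_mem_nhdsWithin] with ε hε
  exact (integral_laplacian_regLog_mul hε h).symm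

lemma abs_log_le_four_div {r : ℝ} (h0 : 0 < r) (h2 : r ≤ 2) : |Real.log r| ≤ 4 / r := by
  rw [abs_le]
  constructor
  · have h1 := Real.one_sub_inv_le_log_of_pos h0
    have h3 : 4 / r = 4 * r⁻¹ := div_eq_mul_inv _ _
    have : 0 < r⁻¹ := by positivity
    linarith
  · have h1 := Real.log_le_sub_one_of_pos h0
    rw [le_div_iff₀ h0]
    nlinarith

lemma integrableOn_log_norm_ball :
    IntegrableOn (fun t : Plane => Real.log ‖t‖) (Metric.ball 0 2) := by
  refine integrableOn_ball_of_norm_le_rpow (by simp) (C := 4) (α := 1) (by simp) ?_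
    (Measurable.aestronglyMeasurable (by fun_prop))
  filter_upwards [ae_restrict_mem Metric.isOpen_ball.measurableSet,
    ae_restrict_of_ae (Measure.ae_ne volume (0 : Plane))] with t ht ht0
  rw [Real.rpow_neg_one, ← div_eq_mul_inv]
  exact abs_log_le_four_div (norm_pos_iff.2 ht0) (by simpa using (mem_ball_zero_iff.1 ht).le)

lemma locallyIntegrable_log_norm : LocallyIntegrable fun t : Plane => Real.log ‖t‖ := by
  intro x
  by_cases hx : x = 0
  · subst hx
    exact ⟨_, Metric.ball_mem_nhds 0 two_pos, integrableOn_log_norm_ball⟩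
  · have hcont : ContinuousOn (fun t : Plane => Real.log ‖t‖) {0}ᶜ := fun t ht =>
      ((continuous_norm.continuousAt).log (norm_ne_zero_iff.2 ht)).continuousWithinAt
    have h := hcont.locallyIntegrableOn (μ := volume) (by measurability) x hx
    rwa [isOpen_compl_singleton.nhdsWithin_eq hx] at h

/-- `log |t|` is a multiple of the fundamental solution of the Laplacian: `Δ log |t| = logFlux δ₀`
in the sense of distributions. -/
theorem integral_log_norm_mul_laplacian {h : Plane → ℝ} (hh : ContDiff ℝ 2 h)
    (hc : HasCompactSupport h) :
    ∫ t, Real.log ‖t‖ * (Δ h) t = logFlux * h 0 := by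
  have hlap := continuous_laplacian hh
  have hlapc := hc.laplacian hh
  have hlim : Tendsto (fun ε => ∫ t, regLog ε t * (Δ h) t) (𝓝[>] 0)
      (𝓝 (∫ t, Real.log ‖t‖ * (Δ h) t)) := by
    have hsmall : ∀ᶠ ε : ℝ in 𝓝[>] 0, 0 < ε ∧ ε < 1 := by
      filter_upwards [Ioo_mem_nhdsGT (zero_lt_one' ℝ)] with ε hε using hε
    refine tendsto_integral_filter_of_dominated_convergence
      (fun t => (|Real.log ‖t‖| + 1 / 2 * Real.log (1 + ‖t‖ ^ 2)) * |(Δ h) t|) ?_ ?_ ?_ ?_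
    · filter_upwards [hsmall] with ε hε
      exact ((contDiff_regLog hε.1).continuous.mul hlap).aestronglyMeasurable
    · filter_upwards [hsmall] with ε hε
      filter_upwards [Measure.ae_ne volume (0 : Plane)] with t ht
      have htpos : 0 < ‖t‖ := norm_pos_iff.2 ht
      rw [norm_mul, Real.norm_eq_abs, Real.norm_eq_abs]
      gcongr
      -- For `ε < 1` the regularization lies between `log |t|` and `½ log (1 + |t|²)`.
      have lo : Real.log ‖t‖ ≤ regLog ε t := by
        have h1 : Real.log (‖t‖ ^ 2) ≤ Real.log (ε ^ 2 + ‖t‖ ^ 2) :=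
          Real.log_le_log (by positivity) (by nlinarith [sq_nonneg ε])
        rw [Real.log_pow] at h1
        unfold regLog
        push_cast at h1
        linarith
      have hi : regLog ε t ≤ 1 / 2 * Real.log (1 + ‖t‖ ^ 2) := by
        unfold regLog
        have : ε ^ 2 ≤ 1 := by nlinarith
        have := Real.log_le_log (x := ε ^ 2 + ‖t‖ ^ 2) (by positivity)
          (add_le_add_left this (‖t‖ ^ 2))
        linarith
      have h0 : 0 ≤ Real.log (1 + ‖t‖ ^ 2) := Real.log_nonneg (by nlinarith [sq_nonneg ‖t‖])
      rw [abs_le]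
      constructor
      · linarith [neg_abs_le (Real.log ‖t‖)]
      · linarith [abs_nonneg (Real.log ‖t‖)]
    · simp_rw [add_mul]
      refine Integrable.add ?_ ?_
      · have h1 : Integrable fun t => (Δ h) t • Real.log ‖t‖ :=
          locallyIntegrable_log_norm.integrable_smul_left_of_hasCompactSupport hlap hlapc
        refine h1.norm.congr (Eventually.of_forall fun t => ?_)
        simp [mul_comm]
      · refine Continuous.integrable_of_hasCompactSupport ?_ hlapc.norm.mul_left
        refine Continuous.mul (continuous_const.mul (Continuous.log (by fun_prop) fun t => ?_))
          hlap.abs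
        positivity
    · filter_upwards [Measure.ae_ne volume (0 : Plane)] with t ht
      have htpos : 0 < ‖t‖ := norm_pos_iff.2 ht
      refine Tendsto.mul_const _ ?_
      have h1 : ContinuousAt (fun ε : ℝ => regLog ε t) 0 := by
        unfold regLog
        refine continuousAt_const.mul (ContinuousAt.log (by fun_prop) (by positivity))
      have h2 : regLog 0 t = Real.log ‖t‖ := by
        unfold regLog
        simp [Real.log_pow]
      have h3 := h1.tendsto
      rw [h2] at h3
      exact h3.mono_left nhdsWithin_le_nhds
  refine tendsto_nhds_unique hlim ?_
  refine (tendsto_integral_laplacian_regLog_mul hh.continuous hc).congr' ?_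
  filter_upwards [self_mem_nhdsWithin] with ε hε
  exact (integral_mul_laplacian_eq (mod_cast contDiff_infty.1 (contDiff_regLog hε) 2) hh hc).symm

/-! ### Convolutions with a scalar function -/

section ScalarConvolution

variable {F : Type} [NormedAddCommGroup F] [NormedSpace ℝ F]

/-- The convolution `(K ⋆ g)(x) = ∫ K(t) g(x - t) dt` of a scalar function with a vector-valued
one. -/
noncomputable def smulConv (K : Plane → ℝ) (g : Plane → F) (x : Plane) : F :=
  ∫ t, K t • g (x - t)

lemma smulConv_eq_convolution (K : Plane → ℝ) (g : Plane → F) :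
    smulConv K g = convolution K g (ContinuousLinearMap.lsmul ℝ ℝ) volume := rfl

lemma integrable_smul_comp_sub {K : Plane → ℝ} {g : Plane → F} (hK : LocallyIntegrable K)
    (hg : Continuous g) (hc : HasCompactSupport g) (x : Plane) :
    Integrable fun t => K t • g (x - t) :=
  hc.convolutionExists_right (ContinuousLinearMap.lsmul ℝ ℝ) hK hg x

lemma hasFDerivAt_smulConv {K : Plane → ℝ} {g : Plane → F} (hK : LocallyIntegrable K)
    (hg : ContDiff ℝ 1 g) (hc : HasCompactSupport g) (x : Plane) :
    HasFDerivAt (smulConv K g) (smulConv K (fderiv ℝ g) x) x := by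
  rw [smulConv_eq_convolution]
  exact hc.hasFDerivAt_convolution_right (ContinuousLinearMap.lsmul ℝ ℝ) hK hg x

lemma contDiff_smulConv {K : Plane → ℝ} {g : Plane → F} (hK : LocallyIntegrable K)
    (hg : ContDiff ℝ ∞ g) (hc : HasCompactSupport g) : ContDiff ℝ ∞ (smulConv K g) := by
  rw [smulConv_eq_convolution]
  exact hc.contDiff_convolution_right (n := ⊤) (ContinuousLinearMap.lsmul ℝ ℝ) hK hg

lemma smulConv_add_left {K₀ K₁ : Plane → ℝ} {g : Plane → F} (h₀ : LocallyIntegrable K₀)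
    (h₁ : LocallyIntegrable K₁) (hg : Continuous g) (hc : HasCompactSupport g) :
    smulConv (fun t => K₀ t + K₁ t) g = smulConv K₀ g + smulConv K₁ g := by
  funext x
  simp only [smulConv, add_smul, Pi.add_apply]
  exact integral_add (integrable_smul_comp_sub h₀ hg hc x) (integrable_smul_comp_sub h₁ hg hc x)

lemma smulConv_comm (K g : Plane → ℝ) : smulConv K g = smulConv g K := by
  funext x
  have h := integral_sub_left_eq_self (fun t => K t • g (x - t)) (volume : Measure Plane) x
  simp only [sub_sub_cancel] at h
  rw [smulConv, ← h, smulConv]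
  simp only [smul_eq_mul, mul_comm]

end ScalarConvolution

/-- The derivatives of `K ⋆ g`, placed on `g`, are bounded through the `L¹` norm of `K`. -/
lemma norm_iteratedFDeriv_smulConv_le {K : Plane → ℝ} (hK : Integrable K) {M : ℝ} (k : ℕ) :
    ∀ {F : Type} [NormedAddCommGroup F] [NormedSpace ℝ F] {g : Plane → F}, ContDiff ℝ ∞ g →
      HasCompactSupport g → (∀ x, ‖iteratedFDeriv ℝ k g x‖ ≤ M) →
      ∀ x, ‖iteratedFDeriv ℝ k (smulConv K g) x‖ ≤ (∫ t, ‖K t‖) * M := by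
  induction k with
  | zero =>
    intro F _ _ g hg hc hM x
    simp only [norm_iteratedFDeriv_zero] at hM ⊢
    rw [← integral_mul_const]
    refine norm_integral_le_of_norm_le (hK.norm.mul_const M) (Eventually.of_forall fun t => ?_)
    rw [norm_smul]
    gcongr
    exact hM _
  | succ k ih =>
    intro F _ _ g hg hc hM x
    have h1 : fderiv ℝ (smulConv K g) = smulConv K (fderiv ℝ g) := funext fun y =>
      (hasFDerivAt_smulConv hK.locallyIntegrable (contDiff_infty.1 hg 1) hc y).fderiv
    rw [← norm_iteratedFDeriv_fderiv, h1]
    refine ih (hg.fderiv_right (by simp)) (hc.fderiv ℝ) (fun y => ?_) x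
    rw [norm_iteratedFDeriv_fderiv]
    exact hM y

lemma hasFDerivAt_smulConv_of_bounded {F : Type} [NormedAddCommGroup F] [NormedSpace ℝ F]
    {g : Plane → ℝ} (hg : Continuous g) (hc : HasCompactSupport g) {H : Plane → F}
    (hH : ContDiff ℝ 1 H) {C : ℝ} (hC : ∀ x, ‖fderiv ℝ H x‖ ≤ C) (x : Plane) :
    HasFDerivAt (smulConv g H) (smulConv g (fderiv ℝ H) x) x := by
  have hH' : Continuous (fderiv ℝ H) := hH.continuous_fderiv one_ne_zero
  refine hasFDerivAt_integral_of_dominated_of_fderiv_le (μ := (volume : Measure Plane))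
    (F := fun y t => g t • H (y - t)) (F' := fun y t => g t • fderiv ℝ H (y - t))
    (bound := fun t => ‖g t‖ * C) univ_mem
    ?_ ?_ ?_ ?_ ?_ ?_
  · exact Eventually.of_forall fun y =>
      (hg.smul (hH.continuous.comp (by fun_prop))).aestronglyMeasurable
  · exact (hg.smul (hH.continuous.comp (by fun_prop))).integrable_of_hasCompactSupport
      hc.smul_right
  · exact (hg.smul (hH'.comp (by fun_prop))).aestronglyMeasurable
  · refine Eventually.of_forall fun t y _ => ?_
    rw [norm_smul]
    gcongr
    exact hC _
  · exact (hg.norm.mul continuous_const).integrable_of_hasCompactSupport hc.norm.mul_right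
  · refine Eventually.of_forall fun t y _ => ?_
    have h1 : HasFDerivAt (fun y => H (y - t)) (fderiv ℝ H (y - t)) y :=
      (hasFDerivAt_comp_sub t).2 ((hH.differentiable one_ne_zero) (y - t)).hasFDerivAt
    exact h1.const_smul (g t)

/-- The derivatives of `g ⋆ H`, placed on `H`, are weighted averages of the derivatives of `H`. -/
lemma norm_iteratedFDeriv_smulConv_le_integral {g : Plane → ℝ} (hg : Continuous g)
    (hc : HasCompactSupport g) (k : ℕ) :
    ∀ {F : Type} [NormedAddCommGroup F] [NormedSpace ℝ F] {H : Plane → F}, ContDiff ℝ ∞ H →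
      (∀ j : ℕ, 1 ≤ j → ∃ C, ∀ x, ‖iteratedFDeriv ℝ j H x‖ ≤ C) →
      ∀ x, ‖iteratedFDeriv ℝ k (smulConv g H) x‖ ≤
        ∫ t, ‖g t‖ * ‖iteratedFDeriv ℝ k H (x - t)‖ := by
  induction k with
  | zero =>
    intro F _ _ H hH hb x
    simp only [norm_iteratedFDeriv_zero]
    refine (norm_integral_le_integral_norm _).trans_eq ?_
    simp only [norm_smul]
  | succ k ih =>
    intro F _ _ H hH hb x
    obtain ⟨C, hC⟩ := hb 1 le_rfl
    have h1 : fderiv ℝ (smulConv g H) = smulConv g (fderiv ℝ H) := funext fun y =>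
      (hasFDerivAt_smulConv_of_bounded hg hc (contDiff_infty.1 hH 1)
        (fun z => by simpa using hC z) y).fderiv
    rw [← norm_iteratedFDeriv_fderiv, h1]
    refine (ih (hH.fderiv_right (by simp)) (fun j hj => ?_) x).trans_eq ?_
    · obtain ⟨C, hC⟩ := hb (j + 1) (by omega)
      exact ⟨C, fun y => by rw [norm_iteratedFDeriv_fderiv]; exact hC y⟩
    · simp only [norm_iteratedFDeriv_fderiv]

/-! ### The Newton potential -/

/-- A smooth cutoff on the plane, equal to `1` on the unit disc and supported in the disc of
radius `2`. -/
noncomputable def planeBump : ContDiffBump (0 : Plane) := ⟨1, 2, one_pos, one_lt_two⟩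

lemma planeBump_eq_one {x : Plane} (hx : ‖x‖ ≤ 1) : planeBump x = 1 :=
  planeBump.one_of_mem_closedBall (by simpa [planeBump] using hx)

lemma planeBump_eq_zero {x : Plane} (hx : 2 ≤ ‖x‖) : planeBump x = 0 :=
  planeBump.zero_of_le_dist (by simpa [planeBump] using hx)

/-- The singular part `χ(t) log |t|` of the logarithm. -/
noncomputable def logNear (t : Plane) : ℝ := planeBump t * Real.log ‖t‖

/-- The smooth part `(1 - χ(t)) log |t|` of the logarithm. -/
noncomputable def logFar (t : Plane) : ℝ := (1 - planeBump t) * Real.log ‖t‖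

lemma logNear_eq_zero {x : Plane} (hx : 2 ≤ ‖x‖) : logNear x = 0 := by
  simp [logNear, planeBump_eq_zero hx]

lemma logFar_eq_log {x : Plane} (hx : 2 ≤ ‖x‖) : logFar x = Real.log ‖x‖ := by
  simp [logFar, planeBump_eq_zero hx]

lemma integrable_logNear : Integrable logNear := by
  have h1 : Integrable fun t => planeBump t • Real.log ‖t‖ :=
    locallyIntegrable_log_norm.integrable_smul_left_of_hasCompactSupport planeBump.continuous
      planeBump.hasCompactSupport
  exact h1

lemma contDiff_logFar : ContDiff ℝ ∞ logFar := by
  rw [contDiff_iff_contDiffAt]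
  intro x
  by_cases hx : x = 0
  · subst hx
    have h : logFar =ᶠ[𝓝 0] fun _ => 0 := by
      filter_upwards [planeBump.eventuallyEq_one] with y hy
      simp [logFar, hy]
    exact contDiffAt_const.congr_of_eventuallyEq h
  · exact (contDiffAt_const.sub planeBump.contDiffAt).mul
      ((contDiffAt_id.norm ℝ hx).log (norm_ne_zero_iff.2 hx))

/-- The logarithm is homogeneous of degree zero up to additive constants, so its `k`-th derivative
is homogeneous of degree `-k`. -/
lemma norm_iteratedFDeriv_logFar_smul {k : ℕ} (hk : 1 ≤ k) {a : ℝ} (ha : 1 ≤ a) {z : Plane}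
    (hz : 2 < ‖z‖) :
    a ^ k * ‖iteratedFDeriv ℝ k logFar (a • z)‖ = ‖iteratedFDeriv ℝ k logFar z‖ := by
  have h1 := congrFun (iteratedFDeriv_comp_const_smul (i := k) a
    (contDiff_infty.1 contDiff_logFar k)) z
  have h2 : (fun z => logFar (a • z)) =ᶠ[𝓝 z] fun z => Real.log a + logFar z := by
    filter_upwards [(isOpen_lt continuous_const continuous_norm).mem_nhds hz] with y hy
    have hy' : 2 < ‖y‖ := hy
    rw [logFar_eq_log hy'.le, logFar_eq_log, norm_smul, Real.norm_of_nonneg (by linarith),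
      Real.log_mul (by linarith) (by linarith)]
    rw [norm_smul, Real.norm_of_nonneg (by linarith)]
    nlinarith
  have h3 := h2.iteratedFDeriv ℝ k |>.eq_of_nhds
  rw [h3, fun_iteratedFDeriv_add_apply contDiffAt_const
    (contDiff_infty.1 contDiff_logFar k).contDiffAt,
    iteratedFDeriv_const_of_ne (by omega)] at h1
  have h4 := congrArg norm h1
  rw [norm_smul, norm_pow, Real.norm_of_nonneg (by linarith)] at h4
  simpa using h4.symm

lemma exists_norm_iteratedFDeriv_logFar_le {k : ℕ} (hk : 1 ≤ k) :
    ∃ C, 0 ≤ C ∧ ∀ x, ‖iteratedFDeriv ℝ k logFar x‖ ≤ C / (1 + ‖x‖) ^ k := by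
  obtain ⟨B, hB⟩ := (isCompact_closedBall (0 : Plane) 3).exists_bound_of_continuousOn
    (contDiff_logFar.continuous_iteratedFDeriv (m := k) (mod_cast le_top)).continuousOn
  have hB0 : 0 ≤ B := (norm_nonneg _).trans (hB 0 (by simp))
  refine ⟨4 ^ k * B, by positivity, fun x => ?_⟩
  rw [le_div_iff₀ (by positivity)]
  rcases le_total ‖x‖ 3 with hx | hx
  · have h1 := hB x (by simpa using hx)
    have h2 : (1 + ‖x‖) ^ k ≤ 4 ^ k := by gcongr; linarith
    calc _ ≤ B * 4 ^ k := by gcongr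
      _ = _ := mul_comm _ _
  · -- Scale `x` to the circle of radius `3`.
    set a := ‖x‖ / 3 with ha
    have hapos : 0 < a := by positivity
    have ha1 : 1 ≤ a := by rw [ha]; linarith
    have hz : ‖a⁻¹ • x‖ = 3 := by
      rw [norm_smul, norm_inv, Real.norm_of_nonneg hapos.le, ha]
      field_simp
    have h1 := norm_iteratedFDeriv_logFar_smul hk ha1 (z := a⁻¹ • x) (by rw [hz]; norm_num)
    rw [smul_inv_smul₀ hapos.ne'] at h1
    have h2 := hB (a⁻¹ • x) (by simp [hz])
    have h3 : (1 + ‖x‖) ^ k ≤ (4 * a) ^ k := by gcongr; rw [ha]; linarith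
    calc _ ≤ ‖iteratedFDeriv ℝ k logFar x‖ * (4 * a) ^ k := by gcongr
      _ = 4 ^ k * (a ^ k * ‖iteratedFDeriv ℝ k logFar x‖) := by rw [mul_pow]; ring
      _ ≤ _ := by rw [h1]; gcongr

/-- The Newton potential of `g`: the convolution of `g` with the fundamental solution. -/
noncomputable def newtonPotential (g : Plane → ℝ) (x : Plane) : ℝ :=
  logFlux⁻¹ * smulConv (fun t => Real.log ‖t‖) g x

lemma contDiff_newtonPotential {g : Plane → ℝ} (hg : ContDiff ℝ ∞ g) (hc : HasCompactSupport g) :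
    ContDiff ℝ ∞ (newtonPotential g) :=
  contDiff_const.mul (contDiff_smulConv locallyIntegrable_log_norm hg hc)

lemma fderiv_smulConv_apply {K g : Plane → ℝ} (hK : LocallyIntegrable K) (hg : ContDiff ℝ ∞ g)
    (hc : HasCompactSupport g) (e : Plane) :
    (fun y => fderiv ℝ (smulConv K g) y e) = smulConv K (fun y => fderiv ℝ g y e) := by
  funext y
  rw [(hasFDerivAt_smulConv hK (contDiff_infty.1 hg 1) hc y).fderiv, smulConv,
    ContinuousLinearMap.integral_apply (integrable_smul_comp_sub hK
      ((contDiff_infty.1 hg 1).continuous_fderiv (by norm_num)) (hc.fderiv ℝ) y)]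
  rfl

lemma laplacian_smulConv {K g : Plane → ℝ} (hK : LocallyIntegrable K) (hg : ContDiff ℝ ∞ g)
    (hc : HasCompactSupport g) (x : Plane) :
    (Δ (smulConv K g)) x = smulConv K (Δ g) x := by
  have hd : ∀ e, ContDiff ℝ ∞ fun y => fderiv ℝ g y e := fun e =>
    contDiff_fderiv_apply_const (by simpa using hg) e
  have hdd : ∀ e, ContDiff ℝ ∞ fun z => fderiv ℝ (fun y => fderiv ℝ g y e) z e := fun e =>
    contDiff_fderiv_apply_const (by simpa using hd e) e
  have h1 : Δ g = fun x => ∑ i : Fin 2,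
      fderiv ℝ (fun y => fderiv ℝ g y (EuclideanSpace.single i 1)) x
      (EuclideanSpace.single i 1) :=
    funext (laplacian_eq_sum_fderiv (contDiff_infty.1 hg 2))
  rw [laplacian_eq_sum_fderiv (contDiff_infty.1 (contDiff_smulConv hK hg hc) 2), h1]
  simp only [smulConv, Finset.smul_sum]
  rw [integral_finsetSum]
  · refine Finset.sum_congr rfl fun i _ => ?_
    rw [fderiv_smulConv_apply hK hg hc]
    exact congrFun (fderiv_smulConv_apply hK (hd _) (hc.fderiv_apply_const _) _) x
  · exact fun i _ => integrable_smul_comp_sub hK (hdd _).continuous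
      ((hc.fderiv_apply_const _).fderiv_apply_const _) x

lemma laplacian_comp_const_sub {g : Plane → ℝ} (hg : ContDiff ℝ 2 g) (x t : Plane) :
    (Δ (fun s => g (x - s))) t = (Δ g) (x - t) := by
  have h1 : ∀ (h : Plane → ℝ) (e : Plane), Differentiable ℝ h →
      (fun y => fderiv ℝ (fun s => h (x - s)) y e) = fun y => -fderiv ℝ h (x - y) e := by
    intro h e hh
    funext y
    have h2 : HasFDerivAt (fun s => h (x - s))
        ((fderiv ℝ h (x - y)).comp (-ContinuousLinearMap.id ℝ Plane)) y :=
      (hh (x - y)).hasFDerivAt.comp y ((hasFDerivAt_id y).const_sub x)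
    rw [h2.fderiv]
    simp
  have hgx : ContDiff ℝ 2 fun s => g (x - s) := hg.comp (contDiff_const.sub contDiff_id)
  rw [laplacian_eq_sum_fderiv hgx, laplacian_eq_sum_fderiv hg]
  refine Finset.sum_congr rfl fun i _ => ?_
  rw [h1 g _ (hg.differentiable (by norm_num)), fderiv_fun_neg, neg_apply]
  have h2 := congrFun (h1 (fun z => fderiv ℝ g z (EuclideanSpace.single i 1))
    (EuclideanSpace.single i 1) ((contDiff_fderiv_apply_const (n := 1)
      (by simpa [one_add_one_eq_two] using hg) _).differentiable (by norm_num))) t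
  rw [h2, neg_neg]

/-- The Newton potential solves Poisson's equation. -/
theorem laplacian_newtonPotential {g : Plane → ℝ} (hg : ContDiff ℝ ∞ g)
    (hc : HasCompactSupport g) (x : Plane) : (Δ (newtonPotential g)) x = g x := by
  have hK := locallyIntegrable_log_norm
  have h1 : newtonPotential g = logFlux⁻¹ • smulConv (fun t => Real.log ‖t‖) g := rfl
  have hg2 : ContDiff ℝ 2 g := contDiff_infty.1 hg 2
  rw [h1, InnerProductSpace.laplacian_smul _
    (contDiff_infty.1 (contDiff_smulConv hK hg hc) 2).contDiffAt,
    laplacian_smulConv hK hg hc, smulConv]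
  have h2 := integral_log_norm_mul_laplacian (h := fun s => g (x - s))
    (hg2.comp (contDiff_const.sub contDiff_id)) (hc.comp_homeomorph (Homeomorph.subLeft x))
  simp_rw [laplacian_comp_const_sub hg2] at h2
  simp_rw [smul_eq_mul]
  rw [h2, sub_zero, inv_mul_cancel_left₀ logFlux_pos.ne']

/-- The derivatives of order `k ≥ 1` of the Newton potential of a function supported in the disc of
radius `2` decay like `r⁻ᵏ`, with a constant that depends only on the sup norms of the function and
of its `k`-th derivative. Near the singularity of the logarithm the derivatives fall on `g`,
elsewhere they fall on the logarithm. -/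
theorem exists_norm_iteratedFDeriv_newtonPotential_le {k : ℕ} (hk : 1 ≤ k) :
    ∃ A, 0 ≤ A ∧ ∀ (g : Plane → ℝ) (M : ℝ), ContDiff ℝ ∞ g → (∀ x, 2 ≤ ‖x‖ → g x = 0) →
      (∀ x, ‖g x‖ ≤ M) → (∀ x, ‖iteratedFDeriv ℝ k g x‖ ≤ M) →
      ∀ x, ‖iteratedFDeriv ℝ k (newtonPotential g) x‖ ≤ A * M / (1 + ‖x‖) ^ k := by
  obtain ⟨C, hC0, hC⟩ := exists_norm_iteratedFDeriv_logFar_le hk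
  set N := ∫ t, ‖logNear t‖ with hN
  have hN0 : 0 ≤ N := integral_nonneg fun t => norm_nonneg _
  set V := (volume : Measure Plane).real (Metric.closedBall 0 2) with hV
  have hV0 : 0 ≤ V := measureReal_nonneg
  have hlf := logFlux_pos
  refine ⟨logFlux⁻¹ * (N * 5 ^ k + V * 3 ^ k * C), by positivity,
    fun g M hg hsupp hM hMk x => ?_⟩
  have hM0 : 0 ≤ M := (norm_nonneg _).trans (hM 0)
  have hsub : Function.support g ⊆ Metric.closedBall 0 2 := by
    intro y hy
    by_contra h
    exact hy (hsupp y (by simpa using (not_le.1 fun h' => h (by simpa using h')).le))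
  have hc : HasCompactSupport g := HasCompactSupport.of_support_subset_isCompact
    (isCompact_closedBall 0 2) hsub
  have hnear : LocallyIntegrable logNear := integrable_logNear.locallyIntegrable
  have hfar : LocallyIntegrable logFar := contDiff_logFar.continuous.locallyIntegrable
  have hsplit : newtonPotential g = logFlux⁻¹ • (smulConv logNear g + smulConv logFar g) := by
    rw [← smulConv_add_left hnear hfar hg.continuous hc]
    funext y
    simp only [newtonPotential, Pi.smul_apply, smul_eq_mul, logNear, logFar]
    congr 2
    funext t
    ring
  have s0 := contDiff_infty.1 (contDiff_smulConv hnear hg hc) k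
  have s1 := contDiff_infty.1 (contDiff_smulConv hfar hg hc) k
  rw [hsplit, iteratedFDeriv_const_smul_apply
    (f := smulConv logNear g + smulConv logFar g) (s0.add s1).contDiffAt,
    iteratedFDeriv_add_apply s0.contDiffAt s1.contDiffAt, norm_smul, norm_inv,
    Real.norm_of_nonneg hlf.le]
  have b0 : ‖iteratedFDeriv ℝ k (smulConv logNear g) x‖ ≤ N * M * 5 ^ k / (1 + ‖x‖) ^ k := by
    rcases le_or_gt ‖x‖ 4 with hx | hx
    · refine (norm_iteratedFDeriv_smulConv_le integrable_logNear k hg hc hMk x).trans ?_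
      rw [le_div_iff₀ (by positivity)]
      gcongr
      linarith
    · -- The convolution vanishes outside the disc of radius `4`.
      have hev : smulConv logNear g =ᶠ[𝓝 x] fun _ => 0 := by
        filter_upwards [(isOpen_lt continuous_const continuous_norm).mem_nhds hx] with y hy
        have hy' : 4 < ‖y‖ := hy
        refine integral_eq_zero_of_ae (Eventually.of_forall fun t => ?_)
        rcases le_or_gt 2 ‖t‖ with ht | ht
        · simp [logNear_eq_zero ht]
        · have : 2 ≤ ‖y - t‖ := by linarith [norm_sub_norm_le y t]
          simp [hsupp _ this]
      rw [(hev.iteratedFDeriv ℝ k).eq_of_nhds, iteratedFDeriv_const_of_ne (by omega)]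
      simp only [Pi.zero_apply, norm_zero]
      positivity
  have b1 : ‖iteratedFDeriv ℝ k (smulConv logFar g) x‖ ≤ M * V * (3 ^ k * C / (1 + ‖x‖) ^ k) := by
    rw [smulConv_comm]
    refine (norm_iteratedFDeriv_smulConv_le_integral hg.continuous hc k contDiff_logFar
      (fun j hj => ?_) x).trans ?_
    · obtain ⟨D, hD0, hD⟩ := exists_norm_iteratedFDeriv_logFar_le hj
      refine ⟨D, fun y => (hD y).trans (div_le_self hD0 (one_le_pow₀ ?_))⟩
      linarith [norm_nonneg y]
    · -- For `|t| ≤ 2` the weights `1 + |x - t|` and `1 + |x|` are comparable.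
      have hpt : ∀ t ∈ Metric.closedBall (0 : Plane) 2,
          ‖‖g t‖ * ‖iteratedFDeriv ℝ k logFar (x - t)‖‖ ≤
          M * (3 ^ k * C / (1 + ‖x‖) ^ k) := by
        intro t ht
        have ht' : ‖t‖ ≤ 2 := by simpa using ht
        rw [norm_mul, norm_norm, norm_norm]
        refine mul_le_mul (hM t) ((hC (x - t)).trans ?_) (norm_nonneg _) hM0
        rw [div_le_div_iff₀ (by positivity) (by positivity)]
        have h3 : 1 + ‖x‖ ≤ 3 * (1 + ‖x - t‖) := by
          linarith [norm_sub_norm_le x t, norm_nonneg (x - t)]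
        calc C * (1 + ‖x‖) ^ k ≤ C * (3 * (1 + ‖x - t‖)) ^ k := by gcongr
          _ = _ := by rw [mul_pow]; ring
      have hset : ∫ t, ‖g t‖ * ‖iteratedFDeriv ℝ k logFar (x - t)‖ =
          ∫ t in Metric.closedBall (0 : Plane) 2,
            ‖g t‖ * ‖iteratedFDeriv ℝ k logFar (x - t)‖ := by
        refine (setIntegral_eq_integral_of_forall_compl_eq_zero fun t ht => ?_).symm
        have : g t = 0 := by
          by_contra h
          exact ht (hsub h)
        simp [this]
      rw [hset]
      refine (le_abs_self _).trans ?_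
      refine (norm_setIntegral_le_of_norm_le_const (measure_closedBall_lt_top) hpt).trans_eq ?_
      ring
  calc logFlux⁻¹ * ‖iteratedFDeriv ℝ k (smulConv logNear g) x +
        iteratedFDeriv ℝ k (smulConv logFar g) x‖
      ≤ logFlux⁻¹ * (N * M * 5 ^ k / (1 + ‖x‖) ^ k + M * V * (3 ^ k * C / (1 + ‖x‖) ^ k)) := by
        gcongr
        exact (norm_add_le _ _).trans (add_le_add b0 b1)
    _ = _ := by ring

/-! ### Series of smooth functions -/

/-- All derivatives of the functions `f i` have bounds that are summable over `i`, uniformly on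
every disc. -/
def LocallySummableDerivs {F : Type} [NormedAddCommGroup F] [NormedSpace ℝ F]
    (f : ℕ → Plane → F) : Prop :=
  ∀ (k : ℕ) (R : ℝ), ∃ v : ℕ → ℝ, Summable v ∧
    ∀ i x, ‖x‖ < R → ‖iteratedFDeriv ℝ k (f i) x‖ ≤ v i

namespace LocallySummableDerivs

lemma fderiv {F : Type} [NormedAddCommGroup F] [NormedSpace ℝ F] {f : ℕ → Plane → F}
    (h : LocallySummableDerivs f) : LocallySummableDerivs fun i => fderiv ℝ (f i) := by
  intro k R
  obtain ⟨v, hv, hb⟩ := h (k + 1) R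
  exact ⟨v, hv, fun i x hx => by rw [norm_iteratedFDeriv_fderiv]; exact hb i x hx⟩

lemma summable_norm {F : Type} [NormedAddCommGroup F] [NormedSpace ℝ F] {f : ℕ → Plane → F}
    (h : LocallySummableDerivs f) (k : ℕ) (x : Plane) :
    Summable fun i => ‖iteratedFDeriv ℝ k (f i) x‖ := by
  obtain ⟨v, hv, hb⟩ := h k (‖x‖ + 1)
  exact Summable.of_nonneg_of_le (fun _ => norm_nonneg _) (fun i => hb i x (by linarith)) hv

lemma summable {F : Type} [NormedAddCommGroup F] [NormedSpace ℝ F] [CompleteSpace F]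
    {f : ℕ → Plane → F} (h : LocallySummableDerivs f) (x : Plane) : Summable fun i => f i x :=
  Summable.of_norm (by simpa using h.summable_norm 0 x)

/-- A family whose members vanish at the origin inherits summable bounds from its derivatives. -/
lemma of_fderiv {F : Type} [NormedAddCommGroup F] [NormedSpace ℝ F] {f : ℕ → Plane → F}
    (hf : ∀ i, Differentiable ℝ (f i)) (h0 : ∀ i, f i 0 = 0)
    (h : LocallySummableDerivs fun i => _root_.fderiv ℝ (f i)) : LocallySummableDerivs f := by
  intro k R
  rcases k with _ | k
  · obtain ⟨v, hv, hb⟩ := h 0 R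
    refine ⟨fun i => v i * R, hv.mul_right R, fun i x hx => ?_⟩
    have hR : 0 < R := (norm_nonneg x).trans_lt hx
    have h1 := (convex_ball (0 : Plane) R).norm_image_sub_le_of_norm_fderiv_le (𝕜 := ℝ)
      (f := f i) (C := v i) (fun y _ => (hf i) y)
      (fun y hy => by simpa using hb i y (by simpa using hy))
      (Metric.mem_ball_self hR) (by simpa using hx)
    rw [h0, sub_zero, sub_zero] at h1
    rw [norm_iteratedFDeriv_zero]
    have hv0 : 0 ≤ v i := (norm_nonneg _).trans (hb i x hx)
    exact h1.trans (mul_le_mul_of_nonneg_left hx.le hv0)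
  · obtain ⟨v, hv, hb⟩ := h k R
    exact ⟨v, hv, fun i x hx => by rw [← norm_iteratedFDeriv_fderiv]; exact hb i x hx⟩

lemma hasFDerivAt_tsum {F : Type} [NormedAddCommGroup F] [NormedSpace ℝ F] [CompleteSpace F]
    {f : ℕ → Plane → F} (h : LocallySummableDerivs f) (hf : ∀ i, Differentiable ℝ (f i))
    (x : Plane) : HasFDerivAt (fun y => ∑' i, f i y) (∑' i, _root_.fderiv ℝ (f i) x) x := by
  obtain ⟨v, hv, hb⟩ := h 1 (‖x‖ + 1)
  have hx : x ∈ Metric.ball (0 : Plane) (‖x‖ + 1) := by simp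
  refine hasFDerivAt_tsum_of_isPreconnected hv Metric.isOpen_ball
    (convex_ball (0 : Plane) (‖x‖ + 1)).isPreconnected (fun i y _ => (hf i y).hasFDerivAt)
    (fun i y hy => ?_) hx (h.summable x) hx
  simpa using hb i y (by simpa using hy)

lemma fderiv_tsum {F : Type} [NormedAddCommGroup F] [NormedSpace ℝ F] [CompleteSpace F]
    {f : ℕ → Plane → F} (h : LocallySummableDerivs f) (hf : ∀ i, Differentiable ℝ (f i)) :
    (_root_.fderiv ℝ fun y => ∑' i, f i y) = fun y => ∑' i, _root_.fderiv ℝ (f i) y :=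
  funext fun x => (h.hasFDerivAt_tsum hf x).fderiv

lemma contDiff_nat_tsum (n : ℕ) : ∀ {F : Type} [NormedAddCommGroup F] [NormedSpace ℝ F]
    [CompleteSpace F] {f : ℕ → Plane → F}, LocallySummableDerivs f →
    (∀ i, ContDiff ℝ ∞ (f i)) → ContDiff ℝ n fun y => ∑' i, f i y := by
  induction n with
  | zero =>
    intro F _ _ _ f h hf
    have hd : ∀ i, Differentiable ℝ (f i) := fun i => (hf i).differentiable (by simp)
    exact contDiff_zero.2
      (show Differentiable ℝ _ from fun x => (h.hasFDerivAt_tsum hd x).differentiableAt).continuous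
  | succ n ih =>
    intro F _ _ _ f h hf
    have hd : ∀ i, Differentiable ℝ (f i) := fun i => (hf i).differentiable (by simp)
    push_cast
    refine contDiff_succ_iff_fderiv.2 ⟨fun x => (h.hasFDerivAt_tsum hd x).differentiableAt,
      by simp, ?_⟩
    rw [h.fderiv_tsum hd]
    exact ih h.fderiv fun i => (hf i).fderiv_right (by simp)

lemma contDiff_tsum {F : Type} [NormedAddCommGroup F] [NormedSpace ℝ F] [CompleteSpace F]
    {f : ℕ → Plane → F} (h : LocallySummableDerivs f) (hf : ∀ i, ContDiff ℝ ∞ (f i)) :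
    ContDiff ℝ ∞ fun y => ∑' i, f i y :=
  contDiff_infty.2 fun n => contDiff_nat_tsum n h hf

lemma norm_iteratedFDeriv_tsum_le (k : ℕ) : ∀ {F : Type} [NormedAddCommGroup F]
    [NormedSpace ℝ F] [CompleteSpace F] {f : ℕ → Plane → F}, LocallySummableDerivs f →
    (∀ i, ContDiff ℝ ∞ (f i)) → ∀ x, ‖iteratedFDeriv ℝ k (fun y => ∑' i, f i y) x‖ ≤
      ∑' i, ‖iteratedFDeriv ℝ k (f i) x‖ := by
  induction k with
  | zero =>
    intro F _ _ _ f h hf x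
    have h1 := h.summable_norm 0 x
    simp only [norm_iteratedFDeriv_zero] at h1 ⊢
    exact norm_tsum_le_tsum_norm h1
  | succ k ih =>
    intro F _ _ _ f h hf x
    have hd : ∀ i, Differentiable ℝ (f i) := fun i => (hf i).differentiable (by simp)
    rw [← norm_iteratedFDeriv_fderiv, h.fderiv_tsum hd]
    refine (ih h.fderiv (fun i => (hf i).fderiv_right (by simp)) x).trans_eq ?_
    simp only [norm_iteratedFDeriv_fderiv]

lemma laplacian_tsum {f : ℕ → Plane → ℝ} (h : LocallySummableDerivs f)
    (hf : ∀ i, ContDiff ℝ ∞ (f i)) (x : Plane) :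
    (Δ (fun y => ∑' i, f i y)) x = ∑' i, (Δ (f i)) x := by
  have hd : ∀ i, Differentiable ℝ (f i) := fun i => (hf i).differentiable (by simp)
  have hd' : ∀ i, Differentiable ℝ (_root_.fderiv ℝ (f i)) := fun i =>
    ((hf i).fderiv_right (m := ∞) (by simp)).differentiable (by simp)
  have hs := h.fderiv.fderiv.summable x
  have key : ∀ e : Plane, HasSum (fun i => iteratedFDeriv ℝ 2 (f i) x ![e, e])
      (iteratedFDeriv ℝ 2 (fun y => ∑' i, f i y) x ![e, e]) := by
    intro e
    simp only [iteratedFDeriv_two_apply]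
    rw [h.fderiv_tsum hd, (h.fderiv.hasFDerivAt_tsum hd' x).fderiv]
    have h1 := hs.hasSum.mapL
      (ContinuousLinearMap.apply ℝ (Plane →L[ℝ] ℝ) (![e, e] 0))
    exact h1.mapL (ContinuousLinearMap.apply ℝ ℝ (![e, e] 1))
  simp only [laplacian_eq_sum_single]
  exact (hasSum_sum fun i _ => key (EuclideanSpace.single i 1)).tsum_eq.symm

end LocallySummableDerivs

/-! ### Growth of functions from growth of their derivatives -/

/-- Integration of a radial bound on the derivative along rays from the origin. -/
lemma norm_sub_le_of_norm_fderiv_le_radial {F : Type} [NormedAddCommGroup F] [NormedSpace ℝ F]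
    {w : Plane → F} (hw : Differentiable ℝ w) {φ φ' : ℝ → ℝ}
    (hφ : ∀ s, 0 ≤ s → HasDerivAt φ (φ' s) s) (hb : ∀ x, ‖fderiv ℝ w x‖ ≤ φ' ‖x‖) (x : Plane) :
    ‖w x - w 0‖ ≤ φ ‖x‖ - φ 0 := by
  have hline : ∀ t : ℝ, HasDerivAt (fun t : ℝ => w (t • x) - w 0) (fderiv ℝ w (t • x) x) t := by
    intro t
    have h1 : HasDerivAt (fun t : ℝ => t • x) x t := by
      simpa using (hasDerivAt_id t).smul_const x
    exact ((hw (t • x)).hasFDerivAt.comp_hasDerivAt t h1).sub_const _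
  have hB : ∀ t : ℝ, 0 ≤ t →
      HasDerivAt (fun t => φ (t * ‖x‖) - φ 0) (φ' (t * ‖x‖) * ‖x‖) t := by
    intro t ht
    have h1 : HasDerivAt (fun t : ℝ => t * ‖x‖) ‖x‖ t := by
      simpa using (hasDerivAt_id t).mul_const ‖x‖
    exact ((hφ (t * ‖x‖) (by positivity)).comp t h1).sub_const _
  have h := image_norm_le_of_norm_deriv_right_le_deriv_boundary' (a := 0) (b := 1)
    (f := fun t : ℝ => w (t • x) - w 0) (f' := fun t => fderiv ℝ w (t • x) x)
    (B := fun t => φ (t * ‖x‖) - φ 0) (B' := fun t => φ' (t * ‖x‖) * ‖x‖)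
    (fun t _ => (hline t).continuousAt.continuousWithinAt)
    (fun t _ => (hline t).hasDerivWithinAt) (by simp)
    (fun t ht => (hB t ht.1).continuousAt.continuousWithinAt)
    (fun t ht => (hB t ht.1).hasDerivWithinAt)
    (fun t ht => by
      refine ((fderiv ℝ w (t • x)).le_opNorm x).trans ?_
      gcongr
      refine (hb (t • x)).trans_eq ?_
      rw [norm_smul, Real.norm_of_nonneg ht.1])
    (Set.right_mem_Icc.2 zero_le_one)
  simpa using h

/-! ### Dyadic sums -/

/-- The growth `ρ^(2-μ)`, `1 + log ρ` or `1` of the dyadic sums `∑ 2^(j(2-μ))`, `2^j ≤ ρ`. -/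
noncomputable def dyadicGrowth (μ ρ : ℝ) : ℝ :=
  if μ < 2 then ρ ^ (2 - μ) else if μ = 2 then 1 + Real.log ρ else 1

lemma rpow_le_dyadicGrowth (μ : ℝ) {ρ : ℝ} (hρ : 1 ≤ ρ) : ρ ^ (2 - μ) ≤ dyadicGrowth μ ρ := by
  unfold dyadicGrowth
  split_ifs with h1 h2
  · exact le_rfl
  · rw [h2, sub_self, Real.rpow_zero]
    linarith [Real.log_nonneg hρ]
  · exact Real.rpow_le_one_of_one_le_of_nonpos hρ (by linarith)

lemma exists_sum_pow_le_dyadicGrowth (μ : ℝ) :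
    ∃ C, 0 ≤ C ∧ ∀ (n : ℕ) (ρ : ℝ), (2 : ℝ) ^ n ≤ ρ →
      ∑ j ∈ Finset.range (n + 1), ((2 : ℝ) ^ (2 - μ)) ^ j ≤ C * dyadicGrowth μ ρ := by
  unfold dyadicGrowth
  rcases lt_trichotomy μ 2 with h | h | h
  · set q : ℝ := (2 : ℝ) ^ (2 - μ) with hq
    have hq1 : 1 < q := Real.one_lt_rpow one_lt_two (by linarith)
    have hq0 : 0 < q - 1 := by linarith
    refine ⟨q / (q - 1), by positivity, fun n ρ hn => ?_⟩
    rw [if_pos h, geom_sum_eq hq1.ne', div_mul_eq_mul_div]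
    have h1 : q ^ n ≤ ρ ^ (2 - μ) := by
      rw [hq, ← Real.rpow_natCast, ← Real.rpow_mul zero_le_two, mul_comm, Real.rpow_mul zero_le_two,
        Real.rpow_natCast]
      exact Real.rpow_le_rpow (by positivity) hn (by linarith)
    gcongr
    rw [pow_succ]
    nlinarith
  · refine ⟨1 / Real.log 2, one_div_nonneg.2 (Real.log_pos one_lt_two).le, fun n ρ hn => ?_⟩
    have hl := Real.log_pos one_lt_two
    have hl1 : Real.log 2 ≤ 1 := by linarith [Real.log_two_lt_d9]
    have h1 := Real.log_le_log (by positivity) hn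
    rw [Real.log_pow] at h1
    simp only [h, lt_irrefl, if_false, if_true, sub_self, Real.rpow_zero, one_pow,
      Finset.sum_const, Finset.card_range, nsmul_eq_mul, mul_one, Nat.cast_add, Nat.cast_one]
    rw [one_div, ← div_eq_inv_mul, le_div_iff₀ hl]
    linarith
  · set q : ℝ := (2 : ℝ) ^ (2 - μ) with hq
    have hq1 : q < 1 := Real.rpow_lt_one_of_one_lt_of_neg one_lt_two (by linarith)
    have hq0 : 0 < q := Real.rpow_pos_of_pos two_pos _
    refine ⟨(1 - q)⁻¹, by have : 0 < 1 - q := by linarith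
                          positivity, fun n ρ hn => ?_⟩
    rw [if_neg (by linarith), if_neg (by linarith), mul_one,
      ← tsum_geometric_of_lt_one hq0.le hq1]
    exact (summable_geometric_of_lt_one hq0.le hq1).sum_le_tsum _ fun i _ => by positivity

/-- The basic dyadic sum: the terms grow or decay like `2^(j(2-μ))` up to `2^j = ρ`, and decay
geometrically beyond. -/
lemma exists_tsum_le_dyadicGrowth (μ : ℝ) {k : ℕ} (hk : 2 < μ + k) :
    ∃ C, 0 ≤ C ∧ ∀ (ρ : ℝ) (a : ℕ → ℝ), 1 ≤ ρ → (∀ j, 0 ≤ a j) →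
      (∀ j, a j ≤ ((2 : ℝ) ^ (2 - μ)) ^ j * ρ ^ (-(k : ℝ))) →
      (∀ j, a j ≤ ((2 : ℝ) ^ (2 - μ - k)) ^ j) →
      ∑' j, a j ≤ C * (dyadicGrowth μ ρ * ρ ^ (-(k : ℝ))) := by
  obtain ⟨C, hC0, hC⟩ := exists_sum_pow_le_dyadicGrowth μ
  set p : ℝ := (2 : ℝ) ^ (2 - μ - k) with hp
  have hp1 : p < 1 := Real.rpow_lt_one_of_one_lt_of_neg one_lt_two (by linarith)
  have hp0 : 0 < p := Real.rpow_pos_of_pos two_pos _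
  have hp2 : 0 < 1 - p := by linarith
  refine ⟨C + (1 - p)⁻¹, by positivity, fun ρ a hρ ha0 ha1 ha2 => ?_⟩
  obtain ⟨n, hn1, hn2⟩ := exists_nat_pow_near hρ one_lt_two
  have hgeo := summable_geometric_of_lt_one hp0.le hp1
  have hsum : Summable a := Summable.of_nonneg_of_le ha0 ha2 hgeo
  have hρ0 : 0 < ρ := by linarith
  rw [← hsum.sum_add_tsum_nat_add (n + 1), add_mul]
  refine add_le_add ?_ ?_
  · calc ∑ j ∈ Finset.range (n + 1), a j
        ≤ ∑ j ∈ Finset.range (n + 1), ((2 : ℝ) ^ (2 - μ)) ^ j * ρ ^ (-(k : ℝ)) :=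
          Finset.sum_le_sum fun j _ => ha1 j
      _ = (∑ j ∈ Finset.range (n + 1), ((2 : ℝ) ^ (2 - μ)) ^ j) * ρ ^ (-(k : ℝ)) := by
          rw [Finset.sum_mul]
      _ ≤ C * dyadicGrowth μ ρ * ρ ^ (-(k : ℝ)) := by gcongr; exact hC n ρ hn1
      _ = _ := by ring
  · have h1 : p ^ (n + 1) ≤ ρ ^ (2 - μ - k) := by
      rw [hp, ← Real.rpow_natCast, ← Real.rpow_mul zero_le_two, mul_comm, Real.rpow_mul zero_le_two,
        Real.rpow_natCast]
      exact Real.rpow_le_rpow_of_nonpos hρ0 hn2.le (by linarith)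
    have h2 : ρ ^ (2 - μ - k) ≤ dyadicGrowth μ ρ * ρ ^ (-(k : ℝ)) := by
      rw [sub_eq_add_neg (2 - μ), Real.rpow_add hρ0]
      gcongr
      exact rpow_le_dyadicGrowth μ hρ
    calc ∑' j, a (j + (n + 1)) ≤ ∑' j, p ^ (n + 1) * p ^ j := by
          refine Summable.tsum_le_tsum (fun j => (ha2 _).trans_eq (by ring))
            ((summable_nat_add_iff (n + 1)).2 hsum) (hgeo.mul_left _)
      _ = (1 - p)⁻¹ * p ^ (n + 1) := by
          rw [tsum_mul_left, tsum_geometric_of_lt_one hp0.le hp1, mul_comm]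
      _ ≤ _ := by gcongr; exact h1.trans h2

/-! ### Dyadic decomposition of the right-hand side -/

/-- The cutoff of the `j`-th dyadic piece, at unit scale: a disc for `j = 0`, an annulus for
`j ≥ 1`. -/
noncomputable def dyadicBump (j : ℕ) (y : Plane) : ℝ :=
  if j = 0 then planeBump y else planeBump y - planeBump ((2 : ℝ) • y)

/-- The `j`-th dyadic piece of `f`, rescaled to unit scale and unit size. -/
noncomputable def dyadicProfile (μ : ℝ) (f : Plane → ℝ) (j : ℕ) (y : Plane) : ℝ :=
  dyadicBump j y * (((2 : ℝ) ^ j) ^ μ * f ((2 : ℝ) ^ j • y))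

lemma contDiff_dyadicBump (j : ℕ) : ContDiff ℝ ∞ (dyadicBump j) := by
  unfold dyadicBump
  split_ifs
  · exact planeBump.contDiff
  · exact planeBump.contDiff.sub (planeBump.contDiff.comp (contDiff_const_smul (2 : ℝ)))

lemma dyadicBump_eq_zero (j : ℕ) {y : Plane} (hy : 2 ≤ ‖y‖) : dyadicBump j y = 0 := by
  have h2 : 2 ≤ ‖(2 : ℝ) • y‖ := by
    rw [norm_smul, Real.norm_of_nonneg zero_le_two]
    linarith
  unfold dyadicBump
  split_ifs <;> simp [planeBump_eq_zero hy, planeBump_eq_zero h2]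

lemma dyadicBump_succ_eq_zero (j : ℕ) {y : Plane} (hy : ‖y‖ ≤ 1 / 2) :
    dyadicBump (j + 1) y = 0 := by
  have h2 : ‖(2 : ℝ) • y‖ ≤ 1 := by
    rw [norm_smul, Real.norm_of_nonneg zero_le_two]
    linarith
  simp [dyadicBump, planeBump_eq_one h2, planeBump_eq_one (hy.trans (by norm_num))]

lemma hasCompactSupport_of_eq_zero {g : Plane → ℝ} (hg : ∀ y, 2 ≤ ‖y‖ → g y = 0) :
    HasCompactSupport g :=
  HasCompactSupport.intro (isCompact_closedBall 0 2) fun y hy =>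
    hg y (by simpa using (not_le.1 fun h => hy (by simpa using h)).le)

lemma contDiff_dyadicProfile {f : Plane → ℝ} (hf : ContDiff ℝ ∞ f) (μ : ℝ) (j : ℕ) :
    ContDiff ℝ ∞ (dyadicProfile μ f j) :=
  (contDiff_dyadicBump j).mul
    (contDiff_const.mul (hf.comp (contDiff_const_smul ((2 : ℝ) ^ j))))

lemma dyadicProfile_eq_zero (μ : ℝ) (f : Plane → ℝ) (j : ℕ) {y : Plane} (hy : 2 ≤ ‖y‖) :
    dyadicProfile μ f j y = 0 := by
  simp [dyadicProfile, dyadicBump_eq_zero j hy]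

/-- The dyadic cutoffs, moved back to their scales, telescope. -/
lemma sum_dyadicBump (n : ℕ) (x : Plane) :
    ∑ j ∈ Finset.range (n + 1), dyadicBump j (((2 : ℝ) ^ j)⁻¹ • x) =
      planeBump (((2 : ℝ) ^ n)⁻¹ • x) := by
  induction n with
  | zero => simp [dyadicBump]
  | succ n ih =>
    have h : (2 : ℝ) * ((2 : ℝ) ^ (n + 1))⁻¹ = ((2 : ℝ) ^ n)⁻¹ := by
      rw [pow_succ]
      field_simp
    rw [Finset.sum_range_succ, ih]
    simp [dyadicBump, smul_smul, h]

/-- The rescaled dyadic pieces sum to `f`. -/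
lemma tsum_dyadicProfile (μ : ℝ) (f : Plane → ℝ) (x : Plane) :
    ∑' j, ((2 : ℝ) ^ j) ^ (-μ) * dyadicProfile μ f j (((2 : ℝ) ^ j)⁻¹ • x) = f x := by
  have hterm : ∀ j : ℕ, ((2 : ℝ) ^ j) ^ (-μ) * dyadicProfile μ f j (((2 : ℝ) ^ j)⁻¹ • x) =
      dyadicBump j (((2 : ℝ) ^ j)⁻¹ • x) * f x := by
    intro j
    have h2 : (0 : ℝ) < 2 ^ j := by positivity
    have h3 : ((2 : ℝ) ^ j) ^ μ ≠ 0 := (Real.rpow_pos_of_pos h2 μ).ne'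
    rw [dyadicProfile, smul_inv_smul₀ h2.ne', Real.rpow_neg h2.le]
    field_simp
  simp only [hterm]
  obtain ⟨N, hN⟩ := pow_unbounded_of_one_lt ‖x‖ one_lt_two
  have hsmall : ∀ j, N ≤ j → ‖((2 : ℝ) ^ j)⁻¹ • x‖ ≤ 1 := by
    intro j hj
    rw [norm_smul, norm_inv, norm_pow, Real.norm_of_nonneg zero_le_two,
      inv_mul_le_iff₀ (by positivity), mul_one]
    exact hN.le.trans (pow_le_pow_right₀ one_le_two hj)
  rw [tsum_eq_sum (s := Finset.range (N + 1)), ← Finset.sum_mul, sum_dyadicBump,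
    planeBump_eq_one (hsmall N le_rfl), one_mul]
  intro j hj
  have hj' : N + 1 ≤ j := by simpa using hj
  obtain ⟨i, rfl⟩ : ∃ i, j = i + 1 := ⟨j - 1, by omega⟩
  rw [dyadicBump_succ_eq_zero i, zero_mul]
  have h1 := hsmall i (by omega)
  have h : ((2 : ℝ) ^ (i + 1))⁻¹ = 1 / 2 * ((2 : ℝ) ^ i)⁻¹ := by
    rw [pow_succ]
    field_simp
  rw [h, mul_smul, norm_smul]
  norm_num at h1 ⊢
  linarith

lemma exists_norm_iteratedFDeriv_le_of_hasCompactSupport {g : Plane → ℝ} (hg : ContDiff ℝ ∞ g)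
    (hc : HasCompactSupport g) (k : ℕ) : ∃ C, ∀ y, ‖iteratedFDeriv ℝ k g y‖ ≤ C :=
  (hc.iteratedFDeriv k).exists_bound_of_continuous
    (hg.continuous_iteratedFDeriv (m := k) (mod_cast le_top))

/-- The decay of `f` is scale invariant: away from the origin the rescaled functions
`2^(jμ) f(2^j ·)` have derivatives bounded uniformly in `j`. -/
lemma HasSymbolDecay.exists_norm_iteratedFDeriv_scaled_le {μ : ℝ} (hμ : 1 ≤ μ) {f : Plane → ℝ}
    (hf : ContDiff ℝ ∞ f) (hdecay : HasSymbolDecay μ f) (k : ℕ) :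
    ∃ C, ∀ (j : ℕ) (y : Plane), 1 / 2 ≤ ‖y‖ →
      ‖iteratedFDeriv ℝ k (fun y => ((2 : ℝ) ^ j) ^ μ * f ((2 : ℝ) ^ j • y)) y‖ ≤ C := by
  obtain ⟨C, hC⟩ := hdecay k
  refine ⟨|C| * (1 / 2) ^ (-μ - (k : ℝ)), fun j y hy => ?_⟩
  have hy0 : 0 < ‖y‖ := by linarith
  set s : ℝ := 2 ^ j with hs
  have hs0 : 0 < s := by positivity
  have hscale : ContDiff ℝ k fun y => f (s • y) :=
    (contDiff_infty.1 hf k).comp (contDiff_const_smul s)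
  have h1 : iteratedFDeriv ℝ k (fun y => s ^ μ * f (s • y)) y =
      s ^ μ • s ^ k • iteratedFDeriv ℝ k f (s • y) := by
    have h2 := congrFun (iteratedFDeriv_comp_const_smul (i := k) s (contDiff_infty.1 hf k)) y
    rw [← h2]
    exact iteratedFDeriv_const_smul_apply' (a := s ^ μ) hscale.contDiffAt
  have hpos : 0 < s ^ μ := Real.rpow_pos_of_pos hs0 μ
  rw [h1, norm_smul, norm_smul, Real.norm_of_nonneg hpos.le, norm_pow, Real.norm_of_nonneg hs0.le]
  have h3 := hC (s • y) (by simpa [hs0.ne'] using norm_pos_iff.1 hy0)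
  rw [norm_smul, Real.norm_of_nonneg hs0.le, Real.mul_rpow hs0.le hy0.le] at h3
  have h4 : s ^ μ * s ^ k * s ^ (-μ - (k : ℝ)) = 1 := by
    rw [← Real.rpow_natCast, ← Real.rpow_add hs0, ← Real.rpow_add hs0]
    simp
  have h5 : ‖y‖ ^ (-μ - (k : ℝ)) ≤ (1 / 2) ^ (-μ - (k : ℝ)) :=
    Real.rpow_le_rpow_of_nonpos (by norm_num) hy (by
      have : (0 : ℝ) ≤ k := k.cast_nonneg
      linarith)
  calc s ^ μ * (s ^ k * ‖iteratedFDeriv ℝ k f (s • y)‖)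
      ≤ s ^ μ * (s ^ k * (C * (s ^ (-μ - (k : ℝ)) * ‖y‖ ^ (-μ - (k : ℝ))))) := by gcongr
    _ = (s ^ μ * s ^ k * s ^ (-μ - (k : ℝ))) * (C * ‖y‖ ^ (-μ - (k : ℝ))) := by ring
    _ = C * ‖y‖ ^ (-μ - (k : ℝ)) := by rw [h4, one_mul]
    _ ≤ |C| * (1 / 2) ^ (-μ - (k : ℝ)) := by
      gcongr
      exact le_abs_self C

/-- The rescaled dyadic pieces are bounded in `C^k`, uniformly in the scale. -/
lemma HasSymbolDecay.exists_norm_iteratedFDeriv_dyadicProfile_le {μ : ℝ} (hμ : 1 ≤ μ)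
    {f : Plane → ℝ} (hf : ContDiff ℝ ∞ f) (hdecay : HasSymbolDecay μ f) (k : ℕ) :
    ∃ M, ∀ j y, ‖iteratedFDeriv ℝ k (dyadicProfile μ f j) y‖ ≤ M := by
  obtain ⟨M₀, hM₀⟩ := exists_norm_iteratedFDeriv_le_of_hasCompactSupport
    (contDiff_dyadicProfile hf μ 0)
    (hasCompactSupport_of_eq_zero fun y hy => dyadicProfile_eq_zero μ f 0 hy) k
  choose B hB using fun i => exists_norm_iteratedFDeriv_le_of_hasCompactSupport
    (contDiff_dyadicBump 1) (hasCompactSupport_of_eq_zero fun y hy => dyadicBump_eq_zero 1 hy) i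
  choose C hC using fun i => hdecay.exists_norm_iteratedFDeriv_scaled_le hμ hf i
  set M₁ := ∑ i ∈ Finset.range (k + 1), (k.choose i : ℝ) * |B i| * |C (k - i)|
  have hM₁ : 0 ≤ M₁ := Finset.sum_nonneg fun i _ => by positivity
  refine ⟨max M₀ M₁, fun j y => ?_⟩
  rcases j with _ | j
  · exact (hM₀ y).trans (le_max_left _ _)
  refine le_trans ?_ (le_max_right _ _)
  rcases lt_or_ge ‖y‖ (1 / 2) with hy | hy
  · have hev : dyadicProfile μ f (j + 1) =ᶠ[𝓝 y] fun _ => 0 := by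
      filter_upwards [(isOpen_lt continuous_norm continuous_const).mem_nhds hy] with z hz
      have hz' : ‖z‖ < 1 / 2 := hz
      simp [dyadicProfile, dyadicBump_succ_eq_zero j hz'.le]
    rw [(hev.iteratedFDeriv ℝ k).eq_of_nhds]
    simpa using hM₁
  · have hb : dyadicBump (j + 1) = dyadicBump 1 := by
      funext z
      simp [dyadicBump]
    have hs : ContDiff ℝ ∞ fun y => ((2 : ℝ) ^ (j + 1)) ^ μ * f ((2 : ℝ) ^ (j + 1) • y) :=
      contDiff_const.mul (hf.comp (contDiff_const_smul _))
    refine (norm_iteratedFDeriv_mul_le (contDiff_dyadicBump (j + 1)) hs y (n := k)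
      (mod_cast le_top)).trans (Finset.sum_le_sum fun i _ => ?_)
    rw [hb]
    gcongr
    · exact (hB i y).trans (le_abs_self _)
    · exact (hC (k - i) (j + 1) y hy).trans (le_abs_self _)

/-! ### The potentials of the dyadic pieces -/

/-- The Newton potential of the `j`-th dyadic piece of `f`, obtained by scaling from the potential
of its profile. -/
noncomputable def dyadicPotential (μ : ℝ) (f : Plane → ℝ) (j : ℕ) (x : Plane) : ℝ :=
  ((2 : ℝ) ^ j) ^ (2 - μ) * newtonPotential (dyadicProfile μ f j) (((2 : ℝ) ^ j)⁻¹ • x)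

lemma contDiff_newtonPotential_dyadicProfile {f : Plane → ℝ} (hf : ContDiff ℝ ∞ f) (μ : ℝ)
    (j : ℕ) : ContDiff ℝ ∞ (newtonPotential (dyadicProfile μ f j)) :=
  contDiff_newtonPotential (contDiff_dyadicProfile hf μ j)
    (hasCompactSupport_of_eq_zero fun _ hy => dyadicProfile_eq_zero μ f j hy)

lemma contDiff_dyadicPotential {f : Plane → ℝ} (hf : ContDiff ℝ ∞ f) (μ : ℝ) (j : ℕ) :
    ContDiff ℝ ∞ (dyadicPotential μ f j) :=
  contDiff_const.mul
    ((contDiff_newtonPotential_dyadicProfile hf μ j).comp (contDiff_const_smul _))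

lemma iteratedFDeriv_dyadicPotential {f : Plane → ℝ} (hf : ContDiff ℝ ∞ f) (μ : ℝ) (j k : ℕ)
    (x : Plane) : iteratedFDeriv ℝ k (dyadicPotential μ f j) x =
      ((2 : ℝ) ^ j) ^ (2 - μ) • (((2 : ℝ) ^ j)⁻¹) ^ k •
        iteratedFDeriv ℝ k (newtonPotential (dyadicProfile μ f j)) (((2 : ℝ) ^ j)⁻¹ • x) := by
  have hv := contDiff_infty.1 (contDiff_newtonPotential_dyadicProfile hf μ j) k
  have h2 := congrFun (iteratedFDeriv_comp_const_smul (i := k) (((2 : ℝ) ^ j)⁻¹) hv) x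
  rw [← h2]
  exact iteratedFDeriv_const_smul_apply' (a := ((2 : ℝ) ^ j) ^ (2 - μ))
    (hv.comp (contDiff_const_smul (((2 : ℝ) ^ j)⁻¹))).contDiffAt

lemma laplacian_dyadicPotential {f : Plane → ℝ} (hf : ContDiff ℝ ∞ f) (μ : ℝ) (j : ℕ)
    (x : Plane) : (Δ (dyadicPotential μ f j)) x =
      ((2 : ℝ) ^ j) ^ (-μ) * dyadicProfile μ f j (((2 : ℝ) ^ j)⁻¹ • x) := by
  have h2 : (0 : ℝ) < 2 ^ j := by positivity
  rw [← laplacian_newtonPotential (contDiff_dyadicProfile hf μ j)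
    (hasCompactSupport_of_eq_zero fun _ hy => dyadicProfile_eq_zero μ f j hy),
    laplacian_eq_sum_single, laplacian_eq_sum_single, Finset.mul_sum]
  refine Finset.sum_congr rfl fun i _ => ?_
  rw [iteratedFDeriv_dyadicPotential hf, smul_apply, smul_apply, smul_eq_mul, smul_eq_mul,
    ← mul_assoc]
  congr 1
  rw [sub_eq_add_neg, Real.rpow_add h2, Real.rpow_two]
  field_simp

/-- The two bounds on the derivatives of the dyadic potentials that enter the dyadic sums: the
first is sharp for scales `2^j ≤ |x|`, the second for scales `2^j ≥ |x|`. -/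
lemma HasSymbolDecay.exists_norm_iteratedFDeriv_dyadicPotential_le {μ : ℝ} (hμ : 1 ≤ μ)
    {f : Plane → ℝ} (hf : ContDiff ℝ ∞ f) (hdecay : HasSymbolDecay μ f) {k : ℕ} (hk : 1 ≤ k) :
    ∃ D, 0 < D ∧ ∀ j x,
      ‖iteratedFDeriv ℝ k (dyadicPotential μ f j) x‖ ≤
        D * (((2 : ℝ) ^ (2 - μ)) ^ j * (1 + ‖x‖) ^ (-(k : ℝ))) ∧
      ‖iteratedFDeriv ℝ k (dyadicPotential μ f j) x‖ ≤ D * ((2 : ℝ) ^ (2 - μ - k)) ^ j := by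
  obtain ⟨A, hA0, hA⟩ := exists_norm_iteratedFDeriv_newtonPotential_le hk
  obtain ⟨M₀, hM₀⟩ := hdecay.exists_norm_iteratedFDeriv_dyadicProfile_le hμ hf 0
  obtain ⟨M₁, hM₁⟩ := hdecay.exists_norm_iteratedFDeriv_dyadicProfile_le hμ hf k
  set M := max M₀ M₁ with hM
  have hM0 : 0 ≤ M := (norm_nonneg _).trans ((hM₀ 0 0).trans (le_max_left _ _))
  refine ⟨A * M + 1, by positivity, fun j x => ?_⟩
  set s : ℝ := 2 ^ j with hs
  have hs1 : 1 ≤ s := one_le_pow₀ one_le_two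
  have hs0 : 0 < s := by linarith
  have hpos : 0 < s ^ (2 - μ) := Real.rpow_pos_of_pos hs0 _
  have hq : ((2 : ℝ) ^ (2 - μ)) ^ j = s ^ (2 - μ) := by
    rw [hs, ← Real.rpow_natCast, ← Real.rpow_natCast, ← Real.rpow_mul zero_le_two,
      ← Real.rpow_mul zero_le_two, mul_comm]
  have hp : ((2 : ℝ) ^ (2 - μ - k)) ^ j = s ^ (2 - μ) / s ^ k := by
    rw [← Real.rpow_natCast s k, ← Real.rpow_sub hs0, hs, ← Real.rpow_natCast,
      ← Real.rpow_natCast, ← Real.rpow_mul zero_le_two, ← Real.rpow_mul zero_le_two, mul_comm]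
  have hmain : ‖iteratedFDeriv ℝ k (dyadicPotential μ f j) x‖ ≤
      A * M * (s ^ (2 - μ) / (s + ‖x‖) ^ k) := by
    have h1 := hA (dyadicProfile μ f j) M (contDiff_dyadicProfile hf μ j)
      (fun y hy => dyadicProfile_eq_zero μ f j hy)
      (fun y => by simpa only [norm_iteratedFDeriv_zero] using (hM₀ j y).trans (le_max_left M₀ M₁))
      (fun y => (hM₁ j y).trans (le_max_right _ _)) (s⁻¹ • x)
    rw [iteratedFDeriv_dyadicPotential hf, norm_smul, norm_smul, Real.norm_of_nonneg hpos.le,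
      norm_pow, norm_inv, Real.norm_of_nonneg hs0.le]
    rw [norm_smul, norm_inv, Real.norm_of_nonneg hs0.le] at h1
    calc s ^ (2 - μ) * (s⁻¹ ^ k * _) ≤ s ^ (2 - μ) * (s⁻¹ ^ k * (A * M / (1 + s⁻¹ * ‖x‖) ^ k)) := by
          gcongr
      _ = _ := by
          have h2 : s + ‖x‖ = s * (1 + s⁻¹ * ‖x‖) := by field_simp
          rw [h2, mul_pow, inv_pow]
          field_simp
  have hle : A * M ≤ A * M + 1 := by linarith
  constructor
  · refine hmain.trans ?_
    rw [hq, Real.rpow_neg (by positivity), Real.rpow_natCast, ← div_eq_mul_inv]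
    gcongr
  · refine hmain.trans ?_
    rw [hp]
    gcongr
    linarith [norm_nonneg x]

/-! ### The solution -/

lemma laplacian_congr_of_fderiv_fderiv {a b : Plane → ℝ}
    (h : fderiv ℝ (fderiv ℝ a) = fderiv ℝ (fderiv ℝ b)) : Δ a = Δ b := by
  funext x
  simp only [laplacian_eq_sum_single, iteratedFDeriv_two_apply, h]

/-- The dyadic potentials, normalized by subtraction of an affine function, sum to a solution of
Poisson's equation. Here `m` is an order from which on the normalization does not affect the
derivatives and the derivatives of the potentials are summable. -/
lemma HasSymbolDecay.tsum_normalized_dyadicPotential {μ : ℝ} (hμ : 1 ≤ μ) {f : Plane → ℝ}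
    (hf : ContDiff ℝ ∞ f) (hdecay : HasSymbolDecay μ f) {m : ℕ} (hm1 : 1 ≤ m) (hm : 2 < μ + m)
    {T : ℕ → Plane → ℝ} (hT : ∀ j, ContDiff ℝ ∞ (T j)) (hls : LocallySummableDerivs T)
    (hTk : ∀ k, m ≤ k → ∀ j x,
      ‖iteratedFDeriv ℝ k (T j) x‖ = ‖iteratedFDeriv ℝ k (dyadicPotential μ f j) x‖)
    (hT2 : ∀ j, Δ (T j) = Δ (dyadicPotential μ f j)) :
    ContDiff ℝ ∞ (fun x => ∑' j, T j x) ∧ (∀ x, (Δ (fun x => ∑' j, T j x)) x = f x) ∧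
      ∀ k : ℕ, m ≤ k → ∃ C, 0 ≤ C ∧ ∀ x, ‖iteratedFDeriv ℝ k (fun x => ∑' j, T j x) x‖ ≤
        C * (dyadicGrowth μ (1 + ‖x‖) * (1 + ‖x‖) ^ (-(k : ℝ))) := by
  refine ⟨hls.contDiff_tsum hT, fun x => ?_, fun k hk => ?_⟩
  · rw [hls.laplacian_tsum hT]
    simp only [hT2, laplacian_dyadicPotential hf]
    exact tsum_dyadicProfile μ f x
  · obtain ⟨D, hD0, hD⟩ := hdecay.exists_norm_iteratedFDeriv_dyadicPotential_le hμ hf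
      (hm1.trans hk)
    have hkm : (m : ℝ) ≤ k := by exact_mod_cast hk
    obtain ⟨C, hC0, hC⟩ := exists_tsum_le_dyadicGrowth μ (k := k) (by linarith)
    refine ⟨D * C, by positivity, fun x => ?_⟩
    have h1 := hC (1 + ‖x‖) (fun j => D⁻¹ * ‖iteratedFDeriv ℝ k (T j) x‖)
      (by linarith [norm_nonneg x]) (fun j => by positivity)
      (fun j => by
        rw [inv_mul_le_iff₀ hD0, hTk k hk]
        exact (hD j x).1)
      (fun j => by
        rw [inv_mul_le_iff₀ hD0, hTk k hk]
        exact (hD j x).2)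
    rw [tsum_mul_left, inv_mul_le_iff₀ hD0, ← mul_assoc] at h1
    exact (hls.norm_iteratedFDeriv_tsum_le k hT x).trans h1

lemma HasSymbolDecay.exists_summable_dyadicPotential {μ : ℝ} (hμ : 1 ≤ μ) {f : Plane → ℝ}
    (hf : ContDiff ℝ ∞ f) (hdecay : HasSymbolDecay μ f) {k : ℕ} (hk1 : 1 ≤ k)
    (hk : 2 < μ + k) : ∃ v : ℕ → ℝ, Summable v ∧
      ∀ j x, ‖iteratedFDeriv ℝ k (dyadicPotential μ f j) x‖ ≤ v j := by
  obtain ⟨D, hD0, hD⟩ := hdecay.exists_norm_iteratedFDeriv_dyadicPotential_le hμ hf hk1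
  refine ⟨fun j => D * ((2 : ℝ) ^ (2 - μ - k)) ^ j, ?_, fun j x => (hD j x).2⟩
  exact (summable_geometric_of_lt_one (Real.rpow_pos_of_pos two_pos _).le
    (Real.rpow_lt_one_of_one_lt_of_neg one_lt_two (by linarith))).mul_left D

/-- For `μ > 1` it suffices to subtract constants. -/
theorem HasSymbolDecay.exists_solution_of_one_lt {μ : ℝ} (hμ : 1 < μ) {f : Plane → ℝ}
    (hf : ContDiff ℝ ∞ f) (hdecay : HasSymbolDecay μ f) :
    ∃ u : Plane → ℝ, ContDiff ℝ ∞ u ∧ (∀ x, (Δ u) x = f x) ∧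
      ∀ k : ℕ, 1 ≤ k → ∃ C, 0 ≤ C ∧ ∀ x, ‖iteratedFDeriv ℝ k u x‖ ≤
        C * (dyadicGrowth μ (1 + ‖x‖) * (1 + ‖x‖) ^ (-(k : ℝ))) := by
  set T : ℕ → Plane → ℝ := fun j x => dyadicPotential μ f j x - dyadicPotential μ f j 0 with hT
  have hP := contDiff_dyadicPotential hf μ
  have hTs : ∀ j, ContDiff ℝ ∞ (T j) := fun j => (hP j).sub contDiff_const
  have hfd : ∀ j, fderiv ℝ (T j) = fderiv ℝ (dyadicPotential μ f j) := fun j =>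
    funext fun x => fderiv_sub_const _
  have hls : LocallySummableDerivs T := by
    refine .of_fderiv (fun j => (hTs j).differentiable (by simp)) (fun j => by simp [hT])
      fun k R => ?_
    obtain ⟨v, hv, hb⟩ := hdecay.exists_summable_dyadicPotential hμ.le hf (k := k + 1)
      (by omega) (by push_cast; linarith [(k.cast_nonneg : (0 : ℝ) ≤ k)])
    refine ⟨v, hv, fun j x _ => ?_⟩
    simp only [hfd, norm_iteratedFDeriv_fderiv]
    exact hb j x
  refine ⟨_, hdecay.tsum_normalized_dyadicPotential hμ.le hf (m := 1) le_rfl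
    (by push_cast; linarith) hTs hls (fun k hk j x => ?_)
    fun j => laplacian_congr_of_fderiv_fderiv (by rw [hfd])⟩
  obtain ⟨k, rfl⟩ : ∃ i, k = i + 1 := ⟨k - 1, by omega⟩
  rw [← norm_iteratedFDeriv_fderiv, hfd, norm_iteratedFDeriv_fderiv]

/-- For `μ = 1` the gradients of the dyadic potentials at the origin are bounded but not summable,
and affine functions have to be subtracted. -/
theorem HasSymbolDecay.exists_solution_of_eq_one {f : Plane → ℝ}
    (hf : ContDiff ℝ ∞ f) (hdecay : HasSymbolDecay 1 f) :
    ∃ u : Plane → ℝ, ContDiff ℝ ∞ u ∧ (∀ x, (Δ u) x = f x) ∧ fderiv ℝ u 0 = 0 ∧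
      ∀ k : ℕ, 2 ≤ k → ∃ C, 0 ≤ C ∧ ∀ x, ‖iteratedFDeriv ℝ k u x‖ ≤
        C * (dyadicGrowth 1 (1 + ‖x‖) * (1 + ‖x‖) ^ (-(k : ℝ))) := by
  set P := dyadicPotential 1 f with hPdef
  set T : ℕ → Plane → ℝ := fun j x => P j x - P j 0 - fderiv ℝ (P j) 0 x with hT
  have hP : ∀ j, ContDiff ℝ ∞ (P j) := contDiff_dyadicPotential hf 1
  have hTs : ∀ j, ContDiff ℝ ∞ (T j) := fun j =>
    ((hP j).sub contDiff_const).sub (fderiv ℝ (P j) 0).contDiff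
  have hfd : ∀ j, fderiv ℝ (T j) = fun x => fderiv ℝ (P j) x - fderiv ℝ (P j) 0 := fun j =>
    funext fun x => (((((hP j).differentiable (by simp)) x).hasFDerivAt.sub_const _).sub
      (fderiv ℝ (P j) 0).hasFDerivAt).fderiv
  have hfd2 : ∀ j, fderiv ℝ (fderiv ℝ (T j)) = fderiv ℝ (fderiv ℝ (P j)) := fun j => by
    rw [hfd]
    exact funext fun x => fderiv_sub_const _
  have hls : LocallySummableDerivs T := by
    refine .of_fderiv (fun j => (hTs j).differentiable (by simp)) (fun j => by simp [hT])
      (.of_fderiv (fun j => ((hTs j).fderiv_right (m := ∞) (by simp)).differentiable (by simp))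
        (fun j => by simp [hfd]) fun k R => ?_)
    obtain ⟨v, hv, hb⟩ := hdecay.exists_summable_dyadicPotential le_rfl hf (k := k + 2)
      (by omega) (by push_cast; linarith [(k.cast_nonneg : (0 : ℝ) ≤ k)])
    refine ⟨v, hv, fun j x _ => ?_⟩
    simp only [hfd2, norm_iteratedFDeriv_fderiv]
    exact hb j x
  have hmain := hdecay.tsum_normalized_dyadicPotential le_rfl hf (m := 2) one_le_two
    (by norm_num) hTs hls (fun k hk j x => by
      obtain ⟨k, rfl⟩ : ∃ i, k = i + 2 := ⟨k - 2, by omega⟩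
      rw [← norm_iteratedFDeriv_fderiv, ← norm_iteratedFDeriv_fderiv, hfd2,
        norm_iteratedFDeriv_fderiv, norm_iteratedFDeriv_fderiv])
    fun j => laplacian_congr_of_fderiv_fderiv (hfd2 j)
  refine ⟨_, hmain.1, hmain.2.1, ?_, hmain.2.2⟩
  rw [hls.fderiv_tsum fun j => (hTs j).differentiable (by simp)]
  simp [hfd]

/-! ### The solution classes -/

lemma derivBigO_of_le {u : Plane → ℝ} {k : ℕ} {φ : ℝ → ℝ} (C : ℝ)
    (h : ∀ x, 2 ≤ ‖x‖ → ‖iteratedFDeriv ℝ k u x‖ ≤ C * φ ‖x‖) (hC : 0 ≤ C) :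
    DerivBigO u k φ := by
  refine Asymptotics.IsBigO.of_bound C ?_
  filter_upwards [eventually_cobounded_le_norm (2 : ℝ)] with x hx
  exact (h x hx).trans (by gcongr; exact le_abs_self _)

lemma log_one_add_le {r : ℝ} (hr : 2 ≤ r) : Real.log (1 + r) ≤ 2 * Real.log r := by
  have h := Real.log_le_log (show 0 < 1 + r by linarith) (show 1 + r ≤ r ^ 2 by nlinarith)
  rw [Real.log_pow] at h
  exact_mod_cast h

lemma one_le_two_mul_log {r : ℝ} (hr : 2 ≤ r) : 1 ≤ 2 * Real.log r := by
  have h := Real.log_le_log two_pos hr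
  linarith [Real.log_two_gt_d9]

lemma one_add_rpow_le {r s : ℝ} (hr : 2 ≤ r) (hs : s ≤ 0) : (1 + r) ^ s ≤ r ^ s :=
  Real.rpow_le_rpow_of_nonpos (by linarith) (by linarith) hs

lemma hasDerivAt_log_one_add {s : ℝ} (hs : 0 ≤ s) :
    HasDerivAt (fun s => Real.log (1 + s)) (1 + s)⁻¹ s := by
  have h := ((hasDerivAt_id s).const_add 1).log (by simp; linarith)
  simpa using h

lemma mem_dClassLog {μ : ℝ} (hμ : 2 < μ) {u : Plane → ℝ} (hu : ContDiff ℝ ∞ u)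
    (h : ∀ k : ℕ, 1 ≤ k → ∃ C, 0 ≤ C ∧ ∀ x, ‖iteratedFDeriv ℝ k u x‖ ≤
      C * (dyadicGrowth μ (1 + ‖x‖) * (1 + ‖x‖) ^ (-(k : ℝ)))) : u ∈ DClassLog := by
  have hg : ∀ ρ, dyadicGrowth μ ρ = 1 := fun ρ => by
    rw [dyadicGrowth, if_neg (by linarith), if_neg (by linarith)]
  simp only [hg, one_mul] at h
  refine ⟨hu, ?_, fun k hk => ?_⟩
  · obtain ⟨C, hC0, hC⟩ := h 1 le_rfl
    refine derivBigO_of_le (2 * |u 0| + C * 2) (fun x hx => ?_) (by positivity)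
    have h1 := norm_sub_le_of_norm_fderiv_le_radial (hu.differentiable (by simp))
      (φ := fun s => C * Real.log (1 + s)) (φ' := fun s => C * (1 + s)⁻¹)
      (fun s hs => (hasDerivAt_log_one_add hs).const_mul C)
      (fun x => by simpa [Real.rpow_neg_one] using hC x) x
    simp only [add_zero, Real.log_one, mul_zero, sub_zero] at h1
    have h2 : ‖u x‖ ≤ ‖u x - u 0‖ + ‖u 0‖ := norm_le_norm_sub_add _ _
    rw [norm_iteratedFDeriv_zero]
    rw [Real.norm_eq_abs (u 0)] at h2
    have h3 := mul_le_mul_of_nonneg_left (log_one_add_le hx) hC0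
    have h4 := mul_le_mul_of_nonneg_left (one_le_two_mul_log hx) (abs_nonneg (u 0))
    linarith
  · obtain ⟨C, hC0, hC⟩ := h k hk
    refine derivBigO_of_le C (fun x hx => (hC x).trans ?_) hC0
    exact mul_le_mul_of_nonneg_left (one_add_rpow_le hx (by simp)) hC0

lemma mem_dClassLogSq {u : Plane → ℝ} (hu : ContDiff ℝ ∞ u)
    (h : ∀ k : ℕ, 1 ≤ k → ∃ C, 0 ≤ C ∧ ∀ x, ‖iteratedFDeriv ℝ k u x‖ ≤
      C * (dyadicGrowth 2 (1 + ‖x‖) * (1 + ‖x‖) ^ (-(k : ℝ)))) : u ∈ DClassLogSq := by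
  have hg : ∀ ρ, dyadicGrowth 2 ρ = 1 + Real.log ρ := fun ρ => by
    rw [dyadicGrowth, if_neg (by linarith), if_pos rfl]
  simp only [hg] at h
  refine ⟨hu, ?_, fun k hk => ?_⟩
  · obtain ⟨C, hC0, hC⟩ := h 1 le_rfl
    refine derivBigO_of_le (4 * |u 0| + C * 8) (fun x hx => ?_) (by positivity)
    have h1 := norm_sub_le_of_norm_fderiv_le_radial (hu.differentiable (by simp))
      (φ := fun s => C * ((1 + Real.log (1 + s)) ^ 2 / 2))
      (φ' := fun s => C * ((1 + Real.log (1 + s)) * (1 + s)⁻¹))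
      (fun s hs => by
        have h2 := ((((hasDerivAt_log_one_add hs).const_add 1).pow 2).div_const 2).const_mul C
        refine h2.congr_deriv ?_
        norm_num
        exact Or.inl (by ring))
      (fun x => by simpa [Real.rpow_neg_one] using hC x) x
    simp only [add_zero, Real.log_one] at h1
    have h2 : ‖u x‖ ≤ ‖u x - u 0‖ + ‖u 0‖ := norm_le_norm_sub_add _ _
    rw [norm_iteratedFDeriv_zero]
    rw [Real.norm_eq_abs (u 0)] at h2
    set l := Real.log ‖x‖
    have hl := one_le_two_mul_log hx
    have hl2 := log_one_add_le hx
    have h0 : 0 ≤ Real.log (1 + ‖x‖) := Real.log_nonneg (by linarith)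
    have h5 : (1 + Real.log (1 + ‖x‖)) ^ 2 ≤ (4 * l) ^ 2 := by
      gcongr
      linarith
    have h3 : C * ((1 + Real.log (1 + ‖x‖)) ^ 2 / 2) ≤ C * ((4 * l) ^ 2 / 2) := by gcongr
    have h6 : 1 ≤ 4 * l ^ 2 := by nlinarith
    have h4 := mul_le_mul_of_nonneg_left h6 (abs_nonneg (u 0))
    nlinarith
  · obtain ⟨C, hC0, hC⟩ := h k hk
    refine derivBigO_of_le (C * 4) (fun x hx => (hC x).trans ?_) (by positivity)
    have hl := one_le_two_mul_log hx
    have hl2 := log_one_add_le hx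
    have h0 : 0 ≤ Real.log (1 + ‖x‖) := Real.log_nonneg (by linarith)
    rw [mul_assoc]
    refine mul_le_mul_of_nonneg_left ?_ hC0
    calc (1 + Real.log (1 + ‖x‖)) * (1 + ‖x‖) ^ (-(k : ℝ))
        ≤ (4 * Real.log ‖x‖) * ‖x‖ ^ (-(k : ℝ)) := by
          refine mul_le_mul (by linarith) (one_add_rpow_le hx (by simp)) (by positivity)
            (by linarith)
      _ = _ := by ring

lemma mem_dClassRPow {μ : ℝ} (h1 : 1 < μ) (h2 : μ < 2) {u : Plane → ℝ} (hu : ContDiff ℝ ∞ u)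
    (h : ∀ k : ℕ, 1 ≤ k → ∃ C, 0 ≤ C ∧ ∀ x, ‖iteratedFDeriv ℝ k u x‖ ≤
      C * (dyadicGrowth μ (1 + ‖x‖) * (1 + ‖x‖) ^ (-(k : ℝ)))) : u ∈ DClassRPow (2 - μ) := by
  have hg : ∀ (k : ℕ) (x : Plane), dyadicGrowth μ (1 + ‖x‖) * (1 + ‖x‖) ^ (-(k : ℝ)) =
      (1 + ‖x‖) ^ (2 - μ - k) := fun k x => by
    rw [dyadicGrowth, if_pos h2, ← Real.rpow_add (by positivity), sub_eq_add_neg (2 - μ)]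
  simp only [hg] at h
  refine ⟨hu, fun k => ?_⟩
  rcases k with _ | k
  · obtain ⟨C, hC0, hC⟩ := h 1 le_rfl
    have hpos : 0 < 2 - μ := by linarith
    refine derivBigO_of_le (|u 0| + C / (2 - μ) * 2 ^ (2 - μ)) (fun x hx => ?_) (by positivity)
    have h3 := norm_sub_le_of_norm_fderiv_le_radial (hu.differentiable (by simp))
      (φ := fun s => C / (2 - μ) * (1 + s) ^ (2 - μ))
      (φ' := fun s => C * (1 + s) ^ (2 - μ - 1))
      (fun s hs => by
        have h4 := (((hasDerivAt_id s).const_add 1).rpow_const (p := 2 - μ)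
          (Or.inl (by simp; linarith))).const_mul (C / (2 - μ))
        refine h4.congr_deriv ?_
        simp only [id]
        field_simp)
      (fun x => by simpa using hC x) x
    simp only [add_zero, Real.one_rpow, mul_one] at h3
    have h4 : ‖u x‖ ≤ ‖u x - u 0‖ + ‖u 0‖ := norm_le_norm_sub_add _ _
    rw [norm_iteratedFDeriv_zero]
    rw [Real.norm_eq_abs (u 0)] at h4
    simp only [Nat.cast_zero, sub_zero]
    have h5 : (1 + ‖x‖) ^ (2 - μ) ≤ 2 ^ (2 - μ) * ‖x‖ ^ (2 - μ) := by
      rw [← Real.mul_rpow zero_le_two (norm_nonneg x)]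
      exact Real.rpow_le_rpow (by positivity) (by linarith) hpos.le
    have h6 := mul_le_mul_of_nonneg_left h5 (show 0 ≤ C / (2 - μ) by positivity)
    have h7 := mul_le_mul_of_nonneg_left
      (Real.one_le_rpow (show 1 ≤ ‖x‖ by linarith) hpos.le) (abs_nonneg (u 0))
    have h8 : 0 ≤ C / (2 - μ) := by positivity
    linarith
  · obtain ⟨C, hC0, hC⟩ := h (k + 1) (by omega)
    refine derivBigO_of_le C (fun x hx => (hC x).trans ?_) hC0
    refine mul_le_mul_of_nonneg_left (one_add_rpow_le hx ?_) hC0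
    push_cast
    linarith [(k.cast_nonneg : (0 : ℝ) ≤ k)]

/-- The bounds on the derivatives of order at least `2` are integrated twice; the gradient has no
additional constant since it vanishes at the origin. -/
lemma mem_dClassRLogR {u : Plane → ℝ} (hu : ContDiff ℝ ∞ u) (hu0 : fderiv ℝ u 0 = 0)
    (h : ∀ k : ℕ, 2 ≤ k → ∃ C, 0 ≤ C ∧ ∀ x, ‖iteratedFDeriv ℝ k u x‖ ≤
      C * (dyadicGrowth 1 (1 + ‖x‖) * (1 + ‖x‖) ^ (-(k : ℝ)))) : u ∈ DClassRLogR := by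
  have hg : ∀ (k : ℕ) (x : Plane), dyadicGrowth 1 (1 + ‖x‖) * (1 + ‖x‖) ^ (-(k : ℝ)) =
      (1 + ‖x‖) ^ (1 - (k : ℝ)) := fun k x => by
    rw [dyadicGrowth, if_pos one_lt_two, ← Real.rpow_add (by positivity)]
    norm_num [sub_eq_add_neg]
  simp only [hg] at h
  obtain ⟨C, hC0, hC⟩ := h 2 le_rfl
  have hgrad : ∀ x, ‖fderiv ℝ u x‖ ≤ C * Real.log (1 + ‖x‖) := by
    intro x
    have h1 := norm_sub_le_of_norm_fderiv_le_radial (w := fderiv ℝ u)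
      ((hu.fderiv_right (m := ∞) (by simp)).differentiable (by simp))
      (φ := fun s => C * Real.log (1 + s)) (φ' := fun s => C * (1 + s)⁻¹)
      (fun s hs => (hasDerivAt_log_one_add hs).const_mul C)
      (fun x => by
        have h2 := hC x
        rw [← norm_iteratedFDeriv_fderiv, norm_iteratedFDeriv_one] at h2
        norm_num [Real.rpow_neg_one] at h2
        exact h2) x
    simpa [hu0] using h1
  refine ⟨hu, ?_, ?_, fun k hk => ?_⟩
  · refine derivBigO_of_le (2 * |u 0| + C * 2) (fun x hx => ?_) (by positivity)
    have h1 := (convex_closedBall (0 : Plane) ‖x‖).norm_image_sub_le_of_norm_fderiv_le (𝕜 := ℝ)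
      (f := u) (C := C * Real.log (1 + ‖x‖)) (fun y _ => (hu.differentiable (by simp)) y)
      (fun y hy => (hgrad y).trans (by
        have hy' : ‖y‖ ≤ ‖x‖ := by simpa using hy
        gcongr))
      (Metric.mem_closedBall_self (norm_nonneg x)) (by simp : x ∈ Metric.closedBall 0 ‖x‖)
    rw [sub_zero] at h1
    have h2 : ‖u x‖ ≤ ‖u x - u 0‖ + ‖u 0‖ := norm_le_norm_sub_add _ _
    rw [norm_iteratedFDeriv_zero]
    rw [Real.norm_eq_abs (u 0)] at h2
    set l := Real.log ‖x‖
    have hl := one_le_two_mul_log hx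
    have h3 : C * Real.log (1 + ‖x‖) * ‖x‖ ≤ C * (2 * l) * ‖x‖ := by
      gcongr
      exact log_one_add_le hx
    have h5 : 1 ≤ 2 * (‖x‖ * l) := by nlinarith
    have h4 := mul_le_mul_of_nonneg_left h5 (abs_nonneg (u 0))
    linarith
  · refine derivBigO_of_le (C * 2) (fun x hx => ?_) (by positivity)
    rw [norm_iteratedFDeriv_one, mul_assoc]
    exact (hgrad x).trans (mul_le_mul_of_nonneg_left (log_one_add_le hx) hC0)
  · obtain ⟨C, hC0, hC⟩ := h k hk
    refine derivBigO_of_le C (fun x hx => (hC x).trans ?_) hC0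
    refine mul_le_mul_of_nonneg_left (one_add_rpow_le hx ?_) hC0
    have : (2 : ℝ) ≤ k := by exact_mod_cast hk
    linarith

lemma DerivBigO.isLittleO_sq {v : Plane → ℝ} {φ : ℝ → ℝ} (h : DerivBigO v 0 φ)
    (hφ : φ =o[atTop] fun r : ℝ => r ^ 2) :
    v =o[Bornology.cobounded Plane] fun x => ‖x‖ ^ 2 := by
  have h1 : v =O[Bornology.cobounded Plane] fun x => iteratedFDeriv ℝ 0 v x :=
    Asymptotics.IsBigO.of_bound 1 (Eventually.of_forall fun x => by simp)
  exact (h1.trans h).trans_isLittleO (hφ.comp_tendsto tendsto_norm_cobounded_atTop)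

lemma rpow_isLittleO_sq {s : ℝ} (hs : s < 2) :
    (fun r : ℝ => r ^ s) =o[atTop] fun r : ℝ => r ^ 2 := by
  refine Asymptotics.isLittleO_of_tendsto' ?_ ?_
  · filter_upwards [eventually_gt_atTop 0] with r hr h
    exact absurd h (by positivity)
  · refine (tendsto_rpow_neg_atTop (show 0 < 2 - s by linarith)).congr' ?_
    filter_upwards [eventually_gt_atTop 0] with r hr
    rw [← Real.rpow_two, ← Real.rpow_sub hr, neg_sub]

/-- Every member of the solution class is smooth and of growth `o(r²)`. -/
lemma InSolutionClass.contDiff_and_isLittleO {μ : ℝ} (hμ : 1 ≤ μ) {v : Plane → ℝ}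
    (hv : InSolutionClass μ v) :
    ContDiff ℝ ∞ v ∧ v =o[Bornology.cobounded Plane] fun x => ‖x‖ ^ 2 := by
  obtain ⟨h1, h2, h3, h4⟩ := hv
  rcases hμ.eq_or_lt with h | h
  · obtain ⟨hc, h0, -⟩ := h1 h.symm
    refine ⟨hc, h0.isLittleO_sq ?_⟩
    have h5 := (Asymptotics.isBigO_refl (fun r : ℝ => r) atTop).mul_isLittleO
      Real.isLittleO_log_id_atTop
    simpa [sq] using h5
  rcases lt_trichotomy μ 2 with h' | h' | h'
  · obtain ⟨hc, h0⟩ := h2 ⟨h, h'⟩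
    refine ⟨hc, (h0 0).isLittleO_sq ?_⟩
    simpa using rpow_isLittleO_sq (s := 2 - μ) (by linarith)
  · obtain ⟨hc, h0, -⟩ := h3 h'
    refine ⟨hc, h0.isLittleO_sq ?_⟩
    exact Real.isLittleO_log_id_atTop.pow two_pos
  · obtain ⟨hc, h0, -⟩ := h4 h'
    refine ⟨hc, h0.isLittleO_sq (Real.isLittleO_log_id_atTop.trans ?_)⟩
    simpa [Function.id_def] using rpow_isLittleO_sq (s := 1) (by norm_num)

/-! ### Existence and uniqueness -/

theorem HasSymbolDecay.exists_solution {μ : ℝ} (hμ : 1 ≤ μ) {f : Plane → ℝ}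
    (hf : ContDiff ℝ ∞ f) (hdecay : HasSymbolDecay μ f) :
    ∃ u : Plane → ℝ, ContDiff ℝ ∞ u ∧ (∀ x, (Δ u) x = f x) ∧ InSolutionClass μ u := by
  rcases hμ.eq_or_lt with rfl | hμ1
  · obtain ⟨u, hu, hΔ, hu0, hk⟩ := hdecay.exists_solution_of_eq_one hf
    refine ⟨u, hu, hΔ, fun _ => mem_dClassRLogR hu hu0 hk, fun h => ?_, fun h => ?_, fun h => ?_⟩
    · exact absurd h.1 (lt_irrefl _)
    · norm_num at h
    · norm_num at h
  · obtain ⟨u, hu, hΔ, hk⟩ := hdecay.exists_solution_of_one_lt hμ1 hf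
    exact ⟨u, hu, hΔ, fun h => absurd h hμ1.ne', fun h => mem_dClassRPow h.1 h.2 hu hk,
      fun h => by subst h; exact mem_dClassLogSq hu hk, fun h => mem_dClassLog h hu hk⟩

lemma differByLinear_of_laplacian_eq {u v f : Plane → ℝ} (hu : ContDiff ℝ 2 u)
    (hv : ContDiff ℝ 2 v) (hΔu : ∀ x, (Δ u) x = f x) (hΔv : ∀ x, (Δ v) x = f x)
    (hou : u =o[Bornology.cobounded Plane] fun x => ‖x‖ ^ 2)
    (hov : v =o[Bornology.cobounded Plane] fun x => ‖x‖ ^ 2) : DifferByLinear v u := by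
  obtain ⟨L, c, h⟩ := exists_affine_of_laplacian_eq_zero_of_isLittleO (w := v - u) (hv.sub hu)
    (fun x => by rw [hv.contDiffAt.laplacian_sub hu.contDiffAt, hΔu, hΔv, sub_self])
    (hov.sub hou)
  exact ⟨L, c, fun x => by rw [← h x, Pi.sub_apply]; ring⟩

lemma DifferByLinear.contDiff_and_laplacian_and_isLittleO {u v : Plane → ℝ}
    (h : DifferByLinear v u) (hu : ContDiff ℝ 2 u)
    (hou : u =o[Bornology.cobounded Plane] fun x => ‖x‖ ^ 2) :
    ContDiff ℝ 2 v ∧ (∀ x, (Δ v) x = (Δ u) x) ∧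
      v =o[Bornology.cobounded Plane] fun x => ‖x‖ ^ 2 := by
  obtain ⟨L, c, h⟩ := h
  set L' : Plane →L[ℝ] ℝ := L.toContinuousLinearMap
  have hv : v = fun x => u x + (L' x + c) := funext h
  have hfd : fderiv ℝ v = fun x => fderiv ℝ u x + L' := by
    rw [hv]
    exact funext fun x => ((((hu.differentiable (by norm_num)) x).hasFDerivAt).add
      (L'.hasFDerivAt.add_const c)).fderiv
  refine ⟨?_, fun x => ?_, ?_⟩
  · rw [hv]
    exact hu.add (L'.contDiff.add contDiff_const)
  · refine congrFun (laplacian_congr_of_fderiv_fderiv ?_) x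
    rw [hfd]
    exact funext fun x => fderiv_add_const _
  · rw [hv]
    refine hou.add ?_
    have h1 : (fun x : Plane => L' x + c) =O[Bornology.cobounded Plane] fun x => ‖x‖ := by
      refine Asymptotics.IsBigO.of_bound (‖L'‖ + ‖c‖) ?_
      filter_upwards [eventually_cobounded_le_norm (1 : ℝ)] with x hx
      rw [norm_norm, add_mul]
      refine (norm_add_le _ _).trans (add_le_add (L'.le_opNorm x) ?_)
      exact le_mul_of_one_le_right (norm_nonneg c) hx
    have h2 : (fun r : ℝ => r) =o[atTop] fun r : ℝ => r ^ 2 := by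
      simpa using rpow_isLittleO_sq (s := 1) (by norm_num)
    exact h1.trans_isLittleO (h2.comp_tendsto tendsto_norm_cobounded_atTop)

theorem mainTheorem7 (μ : ℝ) (hμ : 1 ≤ μ) (f : Plane → ℝ) (hf : ContDiff ℝ ∞ f)
    (hdecay : HasSymbolDecay μ f) :
    ∃ u : Plane → ℝ,
      ContDiff ℝ ∞ u ∧ (∀ x, (Δ u) x = f x) ∧ InSolutionClass μ u ∧
      (∀ v : Plane → ℝ, InSolutionClass μ v → (∀ x, (Δ v) x = f x) → DifferByLinear v u) ∧
      (∀ v : Plane → ℝ,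
        (ContDiff ℝ 2 v ∧ (∀ x, (Δ v) x = f x) ∧
          v =o[Bornology.cobounded Plane] (fun x => ‖x‖ ^ 2)) ↔ DifferByLinear v u) := by
  obtain ⟨u, hu, hΔ, hclass⟩ := hdecay.exists_solution hμ hf
  have hu2 : ContDiff ℝ 2 u := contDiff_infty.1 hu 2
  have hou := (hclass.contDiff_and_isLittleO hμ).2
  refine ⟨u, hu, hΔ, hclass, fun v hv hΔv => ?_, fun v => ⟨fun hv => ?_, fun hv => ?_⟩⟩
  · obtain ⟨hv1, hov⟩ := hv.contDiff_and_isLittleO hμ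
    exact differByLinear_of_laplacian_eq hu2 (contDiff_infty.1 hv1 2) hΔ hΔv hou hov
  · exact differByLinear_of_laplacian_eq hu2 hv.1 hΔ hv.2.1 hou hv.2.2
  · obtain ⟨h1, h2, h3⟩ := hv.contDiff_and_laplacian_and_isLittleO hu2 hou
    exact ⟨h1, fun x => (h2 x).trans (hΔ x), h3⟩
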